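/- In the Euclidean plane or space, consider the Kepler problem around a fixed center ${\rm O}$, $$\ddot q=-\frac{q-{\rm O}}{\|q-{\rm O}\|^{3}},$$ where a rectilinear motion that collides with ${\rm O}$ is extended after the collision: the body bounces off ${\rm O}$, stays on the same ray drawn from ${\rm O}$, and keeps the same total energy $\frac12\|\dot q\|^2-\frac1{\|q-{\rm O}\|}$. A Keplerian arc is such a motion restricted to a bounded closed interval of time $[0,T]$; an arc is called direct if its convex hull does not contain ${\rm O}$. Let ${\rm O}$, ${\rm A}$, ${\rm B}$ be three distinct points such that ${\rm O}$ is not on the segment ${\rm A}{\rm B}$. Choose a positive integer $n$, and consider the Keplerian arcs around ${\rm O}$ starting from ${\rm A}$ (at time $0$), passing again exactly $n$ times through ${\rm A}$ with the initial velocity, and then, after the last of these passages, going from ${\rm A}$ to ${\rm B}$ along a direct arc (at time $T$, the elapsed time). There is a positive time $T_{\min}$, depending on ${\rm O},{\rm A},{\rm B},n$, such that no such arc is travelled in an elapsed time $T<T_{\min}$, a unique such arc is travelled in the elapsed time $T_{\min}$, and exactly two such arcs are travelled in any given elapsed time $T>T_{\min}$. -/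

import Mathlib

namespace KeplerLambert

/-- The Euclidean space of dimension `d` (the plane for `d = 2`, the space for `d = 3`). -/
abbrev Space (d : ℕ) : Type := EuclideanSpace ℝ (Fin d)

/-- `q`, with velocity `v`, is a motion of the Kepler problem around the center `O` during the time
interval `[a, b]`, extended after collision with `O`:
at the times where the body is not at `O` it satisfies Newton's equation
`q'' = -(q - O) / ‖q - O‖ ^ 3` (one-sided derivatives at the ends of the interval);
if the body collides with `O`, it stays on one ray drawn from `O`, where it bounces off `O` and
keeps the same total energy.
The value of `v` at a collision time is irrelevant. Along a motion without collision
`energy` holds automatically, and `finite_collisions` and `bounce` are void. -/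
structure IsKeplerMotion {d : ℕ} (O : Space d) (a b : ℝ) (q v : ℝ → Space d) : Prop where
  continuousOn : ContinuousOn q (Set.Icc a b)
  velocity : ∀ t ∈ Set.Icc a b, q t ≠ O → HasDerivWithinAt q (v t) (Set.Icc a b) t
  newton : ∀ t ∈ Set.Icc a b, q t ≠ O →
    HasDerivWithinAt v (-((‖q t - O‖ ^ 3)⁻¹ • (q t - O))) (Set.Icc a b) t
  energy : ∃ H : ℝ, ∀ t ∈ Set.Icc a b, q t ≠ O → ‖v t‖ ^ 2 / 2 - 1 / ‖q t - O‖ = H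
  finite_collisions : {t ∈ Set.Icc a b | q t = O}.Finite
  bounce : (∃ t ∈ Set.Icc a b, q t = O) →
    ∀ s ∈ Set.Icc a b, ∀ t ∈ Set.Icc a b, SameRay ℝ (q s - O) (q t - O)

/-- The arc described by `q` during `[a, b]` is direct: its convex hull does not contain `O`. -/
def IsDirect {d : ℕ} (O : Space d) (a b : ℝ) (q : ℝ → Space d) : Prop :=
  O ∉ convexHull ℝ (q '' Set.Icc a b)

/-- The times, after the initial time `0` and up to `T`, at which the body is again at its initial
point with its initial velocity. -/
def returnTimes {d : ℕ} (T : ℝ) (q v : ℝ → Space d) : Set ℝ :=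
  {t ∈ Set.Ioc 0 T | q t = q 0 ∧ v t = v 0}

/-- The motion `(q, v)` during `[0, T]` starts from `A`, passes again exactly `n` times through `A`
with the initial velocity, and then, from the last of these passages (at time `s`) to the time `T`,
goes from `A` to `B` along a direct arc. -/
structure IsMultiRevDirect {d : ℕ} (O A B : Space d) (n : ℕ) (T : ℝ) (q v : ℝ → Space d) :
    Prop where
  motion : IsKeplerMotion O 0 T q v
  initial : q 0 = A
  final : q T = B
  passages : (returnTimes T q v).encard = n
  direct : ∃ s, IsGreatest (returnTimes T q v) s ∧ IsDirect O s T q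

/-- The set of all such Keplerian arcs with elapsed time `T`, an arc being a function
on the time interval `[0, T]`. -/
def multiRevDirectArcs {d : ℕ} (O A B : Space d) (n : ℕ) (T : ℝ) :
    Set (Set.Icc (0 : ℝ) T → Space d) :=
  {γ | ∃ q v : ℝ → Space d, IsMultiRevDirect O A B n T q v ∧ ∀ t, γ t = q t}

end KeplerLambert

/-! Passing twice through the same state forces negative energy, since `⟨q - O, v⟩` has derivative
`2 * H + 1 / r`, which is positive off collisions when `0 ≤ H`. Hence each arc in question runs
along an ellipse with focus `O`, flat if there is a collision, and the eccentric anomaly `u`, with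
`du = dt / (√a r)`, regularizes the collisions: in `u` the position is a trigonometric polynomial
(`IsKeplerMotion.exists_isUniformization`). Returns to the initial state are exactly the multiples
of `2π` of `u`, so the final anomaly is `2πn + 2δ` with `0 < δ < π`.

Once `δ` is given, Lambert's problem is linear up to one sign, and directness fixes that sign:
exactly one ellipse remains (`eq_lambertEllipse`, `isKeplerian_lambertEllipse`,
`zero_notMem_convexHull_lambertEllipse`). Thus the arcs with elapsed time `T` correspond bijectively
to the solutions `δ` of `flightTime R κ (n * π) δ = T` (`multiRevDirectArcs_eq_image`,
`injOn_lambertArc`). By Lambert's theorem (`time_lambertEllipse`) the endpoints enter only through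
the mean distance `R` and the invariant `κ`, where `0 < κ < R`.

It remains to count the solutions of a one-variable equation. As `n` is positive, `flightTime` tends
to infinity at both ends of `(0, π)`. Its derivative changes sign only once, because where that sign
is in doubt it is the sign of a strictly increasing function minus `nπ`
(`flightSlope_aux_strictMono`, `flightSlope_pos_of_lt`). Hence the fibres have 0, 1 or 2 elements
(`exists_min_flightTime`). -/

namespace KeplerLambert
open Real Set Filter Topology

/-! ### The elapsed time as a function of `δ`: a single turning point. -/

/-- The semi-major axis of the Keplerian arc joining two points of mean radius `R`, with Lambert
invariant `κ`, along an increment `2 * δ` of the eccentric anomaly. -/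
noncomputable def semiMajor (R κ δ : ℝ) : ℝ := (R - κ * cos δ) / sin δ ^ 2

/-- The corresponding elapsed time, when the increment of the eccentric anomaly
is `2 * (N + δ)`. -/
noncomputable def flightTime (R κ N δ : ℝ) : ℝ :=
  2 * √(semiMajor R κ δ) *
    (semiMajor R κ δ * (N + δ) + (κ - semiMajor R κ δ * cos δ) * sin δ)

lemma sub_mul_cos_pos {R κ : ℝ} (hκ : 0 < κ) (hR : κ < R) (δ : ℝ) : 0 < R - κ * cos δ := by
  nlinarith [cos_le_one δ]

lemma semiMajor_pos {R κ δ : ℝ} (hκ : 0 < κ) (hR : κ < R) (hδ : δ ∈ Ioo 0 π) :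
    0 < semiMajor R κ δ :=
  div_pos (sub_mul_cos_pos hκ hR δ) (pow_pos (sin_pos_of_mem_Ioo hδ) 2)

lemma sin_mul_cos_lt {δ : ℝ} (hδ : 0 < δ) : sin δ * cos δ < δ := by
  have h := sin_lt (by linarith : 0 < 2 * δ)
  rw [sin_two_mul] at h
  linarith

lemma hasDerivAt_semiMajor {R κ δ : ℝ} (hs : sin δ ≠ 0) :
    HasDerivAt (semiMajor R κ) ((κ - 2 * semiMajor R κ δ * cos δ) / sin δ) δ := by
  have h1 : HasDerivAt (fun x => R - κ * cos x) (κ * sin δ) δ := by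
    simpa using ((hasDerivAt_cos δ).const_mul κ).const_sub R
  have h2 : HasDerivAt (fun x => sin x ^ 2) (2 * sin δ * cos δ) δ := by
    simpa using (hasDerivAt_sin δ).fun_pow 2
  refine (h1.div h2 (pow_ne_zero 2 hs)).congr_deriv ?_
  unfold semiMajor
  field_simp

/-- Up to a positive factor, the derivative of `flightTime`. -/
noncomputable def flightSlope (R κ N δ : ℝ) : ℝ :=
  3 * semiMajor R κ δ * ((κ - 2 * semiMajor R κ δ * cos δ) / sin δ) * (N + δ - sin δ * cos δ) +
    4 * semiMajor R κ δ ^ 2 * sin δ ^ 2 + κ ^ 2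

lemma hasDerivAt_flightTime {R κ N δ : ℝ} (hκ : 0 < κ) (hR : κ < R) (hδ : δ ∈ Ioo 0 π) :
    HasDerivAt (flightTime R κ N) ((√(semiMajor R κ δ))⁻¹ * flightSlope R κ N δ) δ := by
  have hs : sin δ ≠ 0 := (sin_pos_of_mem_Ioo hδ).ne'
  have ha := semiMajor_pos hκ hR hδ
  have h1 := hasDerivAt_semiMajor (R := R) (κ := κ) hs
  have h2 := (h1.sqrt ha.ne').const_mul 2
  have h3 : HasDerivAt (fun x => N + x) 1 δ := (hasDerivAt_id δ).const_add N
  have h4 := (h1.mul h3).add (((h1.mul (hasDerivAt_cos δ)).const_sub κ).mul (hasDerivAt_sin δ))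
  refine (h2.mul h4).congr_deriv ?_
  have hq := Real.sq_sqrt ha.le
  have hq0 := (Real.sqrt_pos.mpr ha).ne'
  have hsc := sin_sq_add_cos_sq δ
  simp only [Pi.add_apply, Pi.mul_apply, flightSlope]
  set a := semiMajor R κ δ
  set b := √a
  set s := sin δ
  set c := cos δ
  clear_value s c b a
  subst hq
  field_simp
  have : c ^ 2 = 1 - s ^ 2 := by linarith
  ring_nf
  simp only [this]
  ring

/-- Solving `flightSlope = 0` for `N` gives this function of `δ`, so its monotonicity is what makes
the critical point unique. It is meaningful where `E = 2 R cos - κ (1 + cos ^ 2)` is positive. As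
`E' = -2 sin * (R - κ cos)`, positivity at `y` extends to the left of `y`. -/
lemma flightSlope_aux_strictMono {R κ x y : ℝ} (hκ : 0 < κ) (hR : κ < R) (hx : 0 < x)
    (hxy : x < y) (hy : y < π) (hE : 0 < 2 * R * cos y - κ * (1 + cos y ^ 2)) :
    sin x ^ 3 * (4 * (R - κ * cos x) ^ 2 + κ ^ 2 * sin x ^ 2) /
        (3 * (R - κ * cos x) * (2 * R * cos x - κ * (1 + cos x ^ 2))) - (x - sin x * cos x) <
      sin y ^ 3 * (4 * (R - κ * cos y) ^ 2 + κ ^ 2 * sin y ^ 2) /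
        (3 * (R - κ * cos y) * (2 * R * cos y - κ * (1 + cos y ^ 2))) - (y - sin y * cos y) := by
  have hEz : ∀ z ∈ Icc x y, 0 < 2 * R * cos z - κ * (1 + cos z ^ 2) := by
    intro z hz
    have h1 : cos y ≤ cos z := cos_le_cos_of_nonneg_of_le_pi (hx.le.trans hz.1) hy.le hz.2
    have h2 := cos_le_one z
    have h3 := cos_le_one y
    nlinarith [mul_nonneg (sub_nonneg.2 h1)
      (by nlinarith : 0 ≤ 2 * R - κ * (cos y + cos z))]
  have hD : ∀ z, 0 < R - κ * cos z := sub_mul_cos_pos hκ hR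
  have hd : ∀ z ∈ Icc x y, HasDerivAt (fun x => sin x ^ 3 * (4 * (R - κ * cos x) ^ 2 +
      κ ^ 2 * sin x ^ 2) / (3 * (R - κ * cos x) * (2 * R * cos x - κ * (1 + cos x ^ 2))) -
      (x - sin x * cos x)) (((3 * sin z ^ 2 * cos z * (4 * (R - κ * cos z) ^ 2 +
      κ ^ 2 * sin z ^ 2) + sin z ^ 3 * (8 * (R - κ * cos z) * (κ * sin z) +
      κ ^ 2 * (2 * sin z * cos z))) *
      (3 * (R - κ * cos z) * (2 * R * cos z - κ * (1 + cos z ^ 2))) -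
      sin z ^ 3 * (4 * (R - κ * cos z) ^ 2 + κ ^ 2 * sin z ^ 2) *
      (3 * (κ * sin z) * (2 * R * cos z - κ * (1 + cos z ^ 2)) +
        3 * (R - κ * cos z) * (-(2 * sin z * (R - κ * cos z))))) /
      (3 * (R - κ * cos z) * (2 * R * cos z - κ * (1 + cos z ^ 2))) ^ 2 -
      (1 - (cos z * cos z + sin z * (-sin z)))) z := by
    intro z hz
    have hs := hasDerivAt_sin z
    have hc := hasDerivAt_cos z
    have h1 : HasDerivAt (fun x => R - κ * cos x) (κ * sin z) z := by
      simpa using (hc.const_mul κ).const_sub R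
    have h2 : HasDerivAt (fun x => 2 * R * cos x - κ * (1 + cos x ^ 2))
        (-(2 * sin z * (R - κ * cos z))) z := by
      refine ((hc.const_mul (2 * R)).sub (((hc.pow 2).const_add 1).const_mul κ)).congr_deriv ?_
      simp
      ring
    have h3 : HasDerivAt (fun x => sin x ^ 3 * (4 * (R - κ * cos x) ^ 2 + κ ^ 2 * sin x ^ 2))
        (3 * sin z ^ 2 * cos z * (4 * (R - κ * cos z) ^ 2 + κ ^ 2 * sin z ^ 2) +
          sin z ^ 3 * (8 * (R - κ * cos z) * (κ * sin z) + κ ^ 2 * (2 * sin z * cos z))) z := by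
      refine ((hs.pow 3).mul (((h1.pow 2).const_mul 4).add
        ((hs.pow 2).const_mul (κ ^ 2)))).congr_deriv ?_
      simp only [Nat.cast_ofNat, Nat.add_one_sub_one, pow_one, Pi.pow_apply,
        Pi.add_apply]
      ring
    exact (h3.div ((h1.const_mul 3).mul h2) 
      (mul_pos (mul_pos three_pos (hD z)) (hEz z hz)).ne').sub ((hasDerivAt_id z).sub (hs.mul hc))
  refine strictMonoOn_of_deriv_pos (convex_Icc x y)
    (fun z hz => (hd z hz).continuousAt.continuousWithinAt) ?_ (left_mem_Icc.2 hxy.le)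
    (right_mem_Icc.2 hxy.le) hxy
  intro z hz
  rw [interior_Icc] at hz
  have hz' := Ioo_subset_Icc_self hz
  rw [(hd z hz').deriv]
  have hE := hEz z hz'
  have hD := hD z
  have hs : 0 < sin z := sin_pos_of_pos_of_lt_pi (hx.trans hz.1) (hz.2.trans hy)
  have hsc : cos z ^ 2 = 1 - sin z ^ 2 := by rw [← sin_sq_add_cos_sq z]; ring
  have hc : 0 < cos z := by nlinarith [sq_nonneg (cos z)]
  have hK : κ * sin z ^ 2 = 2 * (R - κ * cos z) * cos z -
      (2 * R * cos z - κ * (1 + cos z ^ 2)) := by nlinarith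
  have h2s : 1 - (cos z * cos z + sin z * (-sin z)) = 2 * sin z ^ 2 := by nlinarith
  rw [h2s, sub_pos, lt_div_iff₀ (by positivity), ← sub_pos]
  set D := R - κ * cos z
  set E := 2 * R * cos z - κ * (1 + cos z ^ 2)
  set s := sin z
  set c := cos z
  clear_value D E s c
  -- After clearing the denominator and substituting `E = 2 D c - κ s ^ 2`, the derivative becomes a
  -- sum of positive monomials.
  have : 0 < 3 * s ^ 4 * (10 * κ * D ^ 2 * E + 3 * κ ^ 2 * c * D * E + κ ^ 2 * E ^ 2 +
      8 * D ^ 4 + 2 * κ ^ 2 * s ^ 2 * D ^ 2) := by positivity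
  refine this.trans_eq ?_
  have hE' : E = 2 * D * c - κ * s ^ 2 := by linarith
  subst hE'
  ring

/-- Once the elapsed time stops decreasing, it increases. -/
lemma flightSlope_pos_of_lt {R κ N x y : ℝ} (hκ : 0 < κ) (hR : κ < R) (hN : 0 < N) (hx : 0 < x)
    (hxy : x < y) (hy : y < π) (h : 0 ≤ flightSlope R κ N x) : 0 < flightSlope R κ N y := by
  have key : ∀ z ∈ Ioo 0 π, flightSlope R κ N z = -3 * ((R - κ * cos z) / sin z ^ 5) *
      (2 * R * cos z - κ * (1 + cos z ^ 2)) * (N + z - sin z * cos z) +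
      4 * semiMajor R κ z ^ 2 * sin z ^ 2 + κ ^ 2 := by
    intro z hz
    have hs := (sin_pos_of_mem_Ioo hz).ne'
    have hsc : sin z ^ 2 = 1 - cos z ^ 2 := by rw [← sin_sq_add_cos_sq z]; ring
    have : (κ - 2 * semiMajor R κ z * cos z) / sin z =
        -(2 * R * cos z - κ * (1 + cos z ^ 2)) / sin z ^ 3 := by
      unfold semiMajor
      field_simp
      rw [hsc]
      ring
    rw [flightSlope, this, semiMajor]
    field_simp
  have hφ : ∀ z, 0 < z → 0 < N + z - sin z * cos z := fun z hz => by
    have := sin_mul_cos_lt hz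
    linarith
  have hyI : y ∈ Ioo 0 π := ⟨hx.trans hxy, hy⟩
  have hxI : x ∈ Ioo 0 π := ⟨hx, hxy.trans hy⟩
  have hsy := sin_pos_of_mem_Ioo hyI
  have hsx := sin_pos_of_mem_Ioo hxI
  have hDy := sub_mul_cos_pos hκ hR y
  have hDx := sub_mul_cos_pos hκ hR x
  -- Only the term containing `E` can be negative; for `E ≤ 0` the slope is at least `κ ^ 2`.
  rcases le_or_gt (2 * R * cos y - κ * (1 + cos y ^ 2)) 0 with hE | hE
  · rw [key y hyI]
    have h1 : 0 ≤ -3 * ((R - κ * cos y) / sin y ^ 5) *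
      (2 * R * cos y - κ * (1 + cos y ^ 2)) * (N + y - sin y * cos y) := by
      have := mul_nonneg (mul_nonneg (div_pos hDy (pow_pos hsy 5)).le (neg_nonneg.2 hE))
        (hφ y hyI.1).le
      linarith
    positivity
  · have hEx : 0 < 2 * R * cos x - κ * (1 + cos x ^ 2) := by
      have h1 : cos y ≤ cos x := cos_le_cos_of_nonneg_of_le_pi hx.le hy.le hxy.le
      have h2 := cos_le_one x
      have h3 := cos_le_one y
      nlinarith [mul_nonneg (sub_nonneg.2 h1)
        (by nlinarith : 0 ≤ 2 * R - κ * (cos y + cos x))]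
    have hmono := flightSlope_aux_strictMono hκ hR hx hxy hy hE
    -- The positive coefficient of `-N` is factored out, leaving the increasing function above minus
    -- `N`.
    have key2 : ∀ z ∈ Ioo 0 π, 0 < 2 * R * cos z - κ * (1 + cos z ^ 2) →
        flightSlope R κ N z = 3 * (R - κ * cos z) / sin z ^ 5 *
          (2 * R * cos z - κ * (1 + cos z ^ 2)) *
          (sin z ^ 3 * (4 * (R - κ * cos z) ^ 2 + κ ^ 2 * sin z ^ 2) /
        (3 * (R - κ * cos z) * (2 * R * cos z - κ * (1 + cos z ^ 2))) - (z - sin z * cos z) - N) := by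
      intro z hz hEz
      have hs := (sin_pos_of_mem_Ioo hz).ne'
      have hD := (sub_mul_cos_pos hκ hR z).ne'
      have hEz := hEz.ne'
      rw [key z hz, semiMajor]
      set D := R - κ * cos z
      set E := 2 * R * cos z - κ * (1 + cos z ^ 2)
      clear_value D E
      field_simp
      ring
    rw [key2 x hxI hEx] at h
    rw [key2 y hyI hE]
    have h1 := nonneg_of_mul_nonneg_right h (by positivity)
    refine mul_pos (by positivity) (by linarith)

/-- The fibres of a continuous function with a single turning point on an open interval, tending to
infinity at both ends. -/
theorem encard_fibre_of_unimodal {f : ℝ → ℝ} {a b m : ℝ} (hm : m ∈ Ioo a b)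
    (hf : ContinuousOn f (Ioo a b)) (ha : Tendsto f (𝓝[>] a) atTop)
    (hb : Tendsto f (𝓝[<] b) atTop) (hanti : StrictAntiOn f (Ioc a m))
    (hmono : StrictMonoOn f (Ico m b)) :
    (∀ T < f m, {x ∈ Ioo a b | f x = T} = ∅) ∧ {x ∈ Ioo a b | f x = f m}.encard = 1 ∧
      ∀ T, f m < T → {x ∈ Ioo a b | f x = T}.encard = 2 := by
  have hmin : ∀ x ∈ Ioo a b, x ≠ m → f m < f x := by
    intro x hx hne
    rcases lt_or_gt_of_ne hne with h | h
    · exact hanti ⟨hx.1, h.le⟩ ⟨hm.1, le_rfl⟩ h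
    · exact hmono ⟨le_rfl, hm.2⟩ ⟨h.le, hx.2⟩ h
  refine ⟨fun T hT => ?_, ?_, fun T hT => ?_⟩
  · ext x
    simp only [mem_ofPred_eq, mem_empty_iff_false, iff_false, not_and]
    rintro hx rfl
    rcases eq_or_ne x m with rfl | h
    · exact lt_irrefl _ hT
    · exact lt_asymm hT (hmin x hx h)
  · rw [encard_eq_one]
    refine ⟨m, ?_⟩
    ext x
    simp only [mem_ofPred_eq, mem_singleton_iff]
    refine ⟨fun h => ?_, by rintro rfl; exact ⟨hm, rfl⟩⟩
    by_contra hne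
    exact (hmin x h.1 hne).ne' h.2
  · obtain ⟨x₁, hx₁, hx₁m, hT₁⟩ : ∃ x, a < x ∧ x < m ∧ T ≤ f x := by
      have h := (ha.eventually_ge_atTop T).and (Ioo_mem_nhdsGT hm.1)
      obtain ⟨x, hx⟩ := h.exists
      exact ⟨x, hx.2.1, hx.2.2, hx.1⟩
    obtain ⟨x₂, hx₂m, hx₂, hT₂⟩ : ∃ x, m < x ∧ x < b ∧ T ≤ f x := by
      have h := (hb.eventually_ge_atTop T).and (Ioo_mem_nhdsLT hm.2)
      obtain ⟨x, hx⟩ := h.exists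
      exact ⟨x, hx.2.1, hx.2.2, hx.1⟩
    obtain ⟨y₁, hy₁, hfy₁⟩ := intermediate_value_Icc' hx₁m.le
      (hf.mono (Icc_subset_Ioo hx₁ hm.2)) ⟨hT.le, hT₁⟩
    obtain ⟨y₂, hy₂, hfy₂⟩ := intermediate_value_Icc hx₂m.le
      (hf.mono (Icc_subset_Ioo hm.1 hx₂)) ⟨hT.le, hT₂⟩
    have hy₁m : y₁ < m := lt_of_le_of_ne hy₁.2 (by rintro rfl; exact hT.ne hfy₁)
    have hy₂m : m < y₂ := lt_of_le_of_ne hy₂.1 (by rintro rfl; exact hT.ne hfy₂)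
    have hy₁a : a < y₁ := hx₁.trans_le hy₁.1
    have hy₂b : y₂ < b := hy₂.2.trans_lt hx₂
    rw [encard_eq_two]
    refine ⟨y₁, y₂, (hy₁m.trans hy₂m).ne, ?_⟩
    ext x
    simp only [mem_ofPred_eq, mem_insert_iff, mem_singleton_iff]
    constructor
    · rintro ⟨hx, hfx⟩
      rcases le_total x m with h | h
      · exact Or.inl (hanti.injOn ⟨hx.1, h⟩ ⟨hy₁a, hy₁m.le⟩ (hfx.trans hfy₁.symm))
      · exact Or.inr (hmono.injOn ⟨h, hx.2⟩ ⟨hy₂m.le, hy₂b⟩ (hfx.trans hfy₂.symm))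
    · rintro (rfl | rfl)
      · exact ⟨⟨hy₁a, hy₁m.trans hm.2⟩, hfy₁⟩
      · exact ⟨⟨hm.1.trans hy₂m, hy₂b⟩, hfy₂⟩

/-- Off a compact subinterval containing `c`, the values are at least `f c`, so the minimum on that
subinterval is global. -/
lemma exists_isMinOn_Ioo_of_tendsto_atTop {f : ℝ → ℝ} {a b : ℝ} (hab : a < b)
    (hf : ContinuousOn f (Ioo a b)) (ha : Tendsto f (𝓝[>] a) atTop)
    (hb : Tendsto f (𝓝[<] b) atTop) : ∃ m ∈ Ioo a b, IsMinOn f (Ioo a b) m := by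
  obtain ⟨c, hc⟩ := exists_between hab
  obtain ⟨x₁, hx₁, h₁⟩ := mem_nhdsGT_iff_exists_Ioo_subset.1 (ha.eventually_ge_atTop (f c))
  obtain ⟨x₂, hx₂, h₂⟩ := mem_nhdsLT_iff_exists_Ioo_subset.1 (hb.eventually_ge_atTop (f c))
  obtain ⟨y₁, hy₁⟩ := exists_between (lt_min hx₁ hc.1)
  obtain ⟨y₂, hy₂⟩ := exists_between (max_lt hx₂ hc.2)
  rw [lt_min_iff] at hy₁
  rw [max_lt_iff] at hy₂
  have hsub : Icc y₁ y₂ ⊆ Ioo a b := Icc_subset_Ioo hy₁.1 hy₂.2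
  have hcI : c ∈ Icc y₁ y₂ := ⟨hy₁.2.2.le, hy₂.1.2.le⟩
  obtain ⟨m, hm, hmin⟩ := isCompact_Icc.exists_isMinOn ⟨c, hcI⟩ (hf.mono hsub)
  refine ⟨m, hsub hm, fun x hx => ?_⟩
  rcases lt_or_ge x y₁ with h | h
  · have h3 : f c ≤ f x := h₁ ⟨hx.1, h.trans hy₁.2.1⟩
    exact (isMinOn_iff.1 hmin c hcI).trans h3
  rcases lt_or_ge y₂ x with h' | h'
  · have h3 : f c ≤ f x := h₂ ⟨hy₂.1.1.trans h', hx.2⟩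
    exact (isMinOn_iff.1 hmin c hcI).trans h3
  exact hmin ⟨h, h'⟩

/-- The difference is `2 √a (a (δ - sin δ cos δ) + κ sin δ)`. For `N > 0` the bound gives both the
positivity of the minimum and the blow-up at the ends, where `a` tends to infinity. -/
lemma lt_flightTime {R κ N δ : ℝ} (hκ : 0 < κ) (hR : κ < R) (hδ : δ ∈ Ioo 0 π) :
    2 * N * (semiMajor R κ δ * √(semiMajor R κ δ)) < flightTime R κ N δ := by
  have ha := semiMajor_pos hκ hR hδ
  have hs := sin_pos_of_mem_Ioo hδ
  have h := sub_pos.2 (sin_mul_cos_lt hδ.1)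
  have hq := Real.sqrt_pos.2 ha
  have : 0 < 2 * √(semiMajor R κ δ) *
    (semiMajor R κ δ * (δ - sin δ * cos δ) + κ * sin δ) := by positivity
  unfold flightTime
  linarith

lemma tendsto_semiMajor {R κ δ : ℝ} {l : Filter ℝ} (h : 0 < R - κ * cos δ) (hl : l ≤ 𝓝 δ)
    (h0 : sin δ = 0) (hs : ∀ᶠ x in l, 0 < sin x) : Tendsto (semiMajor R κ) l atTop := by
  have h1 : Tendsto (fun x => R - κ * cos x) l (𝓝 (R - κ * cos δ)) :=
    ((by fun_prop : Continuous fun x => R - κ * cos x).tendsto δ).mono_left hl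
  have h2 : Tendsto (fun x => sin x ^ 2) l (𝓝[>] 0) := by
    refine tendsto_nhdsWithin_iff.2 ⟨?_, hs.mono fun x hx => pow_pos hx 2⟩
    have := ((by fun_prop : Continuous fun x => sin x ^ 2).tendsto δ).mono_left hl
    simpa [h0] using this
  exact h1.pos_mul_atTop h (tendsto_inv_nhdsGT_zero.comp h2)

lemma tendsto_flightTime {R κ N δ : ℝ} {l : Filter ℝ} (hκ : 0 < κ) (hR : κ < R) (hN : 0 < N)
    (hl : l ≤ 𝓝 δ) (h0 : sin δ = 0) (hs : ∀ᶠ x in l, x ∈ Ioo 0 π) :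
    Tendsto (flightTime R κ N) l atTop := by
  have h1 := tendsto_semiMajor (R := R) (κ := κ) (sub_mul_cos_pos hκ hR δ) hl h0
    (hs.mono fun x hx => sin_pos_of_mem_Ioo hx)
  have h2 : Tendsto (fun x => 2 * N * (semiMajor R κ x * √(semiMajor R κ x))) l atTop :=
    (h1.atTop_mul_atTop₀ (tendsto_sqrt_atTop.comp h1)).const_mul_atTop (by positivity)
  exact tendsto_atTop_mono' l (hs.mono fun x hx => (lt_flightTime hκ hR hx).le) h2

theorem exists_min_flightTime {R κ N : ℝ} (hκ : 0 < κ) (hR : κ < R) (hN : 0 < N) :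
    ∃ Tmin : ℝ, 0 < Tmin ∧
      (∀ T < Tmin, {δ ∈ Ioo 0 π | flightTime R κ N δ = T} = ∅) ∧
      {δ ∈ Ioo 0 π | flightTime R κ N δ = Tmin}.encard = 1 ∧
      ∀ T, Tmin < T → {δ ∈ Ioo 0 π | flightTime R κ N δ = T}.encard = 2 := by
  have hd : ∀ δ ∈ Ioo 0 π, HasDerivAt (flightTime R κ N) _ δ :=
    fun δ hδ => hasDerivAt_flightTime hκ hR hδ
  have hc : ContinuousOn (flightTime R κ N) (Ioo 0 π) :=
    fun δ hδ => (hd δ hδ).continuousAt.continuousWithinAt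
  have h0 : Tendsto (flightTime R κ N) (𝓝[>] 0) atTop :=
    tendsto_flightTime hκ hR hN nhdsWithin_le_nhds sin_zero (Ioo_mem_nhdsGT pi_pos)
  have hπ : Tendsto (flightTime R κ N) (𝓝[<] π) atTop :=
    tendsto_flightTime hκ hR hN nhdsWithin_le_nhds sin_pi (Ioo_mem_nhdsLT pi_pos)
  obtain ⟨m, hm, hmin⟩ := exists_isMinOn_Ioo_of_tendsto_atTop pi_pos hc h0 hπ
  have hq : ∀ δ ∈ Ioo 0 π, 0 < (√(semiMajor R κ δ))⁻¹ := fun δ hδ =>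
    inv_pos.2 (Real.sqrt_pos.2 (semiMajor_pos hκ hR hδ))
  have hm0 : flightSlope R κ N m = 0 := by
    have := (hmin.isLocalMin (Ioo_mem_nhds hm.1 hm.2)).hasDerivAt_eq_zero (hd m hm)
    exact (mul_eq_zero.1 this).resolve_left (hq m hm).ne'
  refine ⟨flightTime R κ N m, ?_, encard_fibre_of_unimodal hm hc h0 hπ ?_ ?_⟩
  · refine lt_trans ?_ (lt_flightTime hκ hR hm)
    have := semiMajor_pos hκ hR hm
    positivity
  · refine strictAntiOn_of_deriv_neg (convex_Ioc 0 m)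
      (hc.mono fun x hx => ⟨hx.1, hx.2.trans_lt hm.2⟩) fun x hx => ?_
    rw [interior_Ioc] at hx
    have hxI : x ∈ Ioo 0 π := ⟨hx.1, hx.2.trans hm.2⟩
    rw [(hd x hxI).deriv]
    -- A nonnegative slope before `m` would make the slope at `m` positive.
    refine mul_neg_of_pos_of_neg (hq x hxI) (not_le.1 fun h => ?_)
    exact (flightSlope_pos_of_lt hκ hR hN hx.1 hx.2 hm.2 h).ne' hm0
  · refine strictMonoOn_of_deriv_pos (convex_Ico m π)
      (hc.mono fun x hx => ⟨hm.1.trans_le hx.1, hx.2⟩) fun x hx => ?_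
    rw [interior_Ico] at hx
    have hxI : x ∈ Ioo 0 π := ⟨hm.1.trans hx.1, hx.2⟩
    rw [(hd x hxI).deriv]
    exact mul_pos (hq x hxI) (flightSlope_pos_of_lt hκ hR hN hm.1 hx.1 hx.2 hm0.ge)

end KeplerLambert

/-! ### Ellipses with a focus at the origin, parametrized by the eccentric anomaly. -/

namespace KeplerLambert
open Real Set Filter Topology

/-- The coefficients of a motion `u ↦ c + cos u • X + sin u • Y`, parametrized by the eccentric
anomaly, and of its distance `u ↦ a + ρ * cos u + σ * sin u` to the origin. -/
@[ext]
structure Ellipse (E : Type*) where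
  a : ℝ
  ρ : ℝ
  σ : ℝ
  c : E
  X : E
  Y : E

namespace Ellipse

variable {E : Type*} [NormedAddCommGroup E] [InnerProductSpace ℝ E]

noncomputable def pos (e : Ellipse E) (u : ℝ) : E := e.c + cos u • e.X + sin u • e.Y

/-- The derivative of the position with respect to the eccentric anomaly. -/
noncomputable def vel (e : Ellipse E) (u : ℝ) : E := -(sin u • e.X) + cos u • e.Y

noncomputable def rad (e : Ellipse E) (u : ℝ) : ℝ := e.a + e.ρ * cos u + e.σ * sin u

/-- The derivative of the distance with respect to the eccentric anomaly. -/
noncomputable def radVel (e : Ellipse E) (u : ℝ) : ℝ := -(e.ρ * sin u) + e.σ * cos u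

/-- Kepler's equation: the time elapsed since the eccentric anomaly was zero. -/
noncomputable def time (e : Ellipse E) (u : ℝ) : ℝ :=
  √e.a * (e.a * u + e.ρ * sin u + e.σ * (1 - cos u))

/-- The same motion, with another origin of the eccentric anomaly. -/
noncomputable def shift (e : Ellipse E) (δ : ℝ) : Ellipse E where
  a := e.a
  ρ := e.ρ * cos δ + e.σ * sin δ
  σ := -(e.ρ * sin δ) + e.σ * cos δ
  c := e.c
  X := cos δ • e.X + sin δ • e.Y
  Y := -(sin δ • e.X) + cos δ • e.Y

/-- The curve is a (possibly flat) ellipse with a focus at the origin. -/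
structure IsKeplerian (e : Ellipse E) : Prop where
  a_pos : 0 < e.a
  inner_X_X : inner ℝ e.X e.X = e.a ^ 2 - e.σ ^ 2
  inner_Y_Y : inner ℝ e.Y e.Y = e.a ^ 2 - e.ρ ^ 2
  inner_X_Y : inner ℝ e.X e.Y = e.ρ * e.σ
  center : e.a • e.c = e.ρ • e.X + e.σ • e.Y
  le : e.ρ ^ 2 + e.σ ^ 2 ≤ e.a ^ 2

lemma pos_shift (e : Ellipse E) (δ u : ℝ) : (e.shift δ).pos u = e.pos (u + δ) := by
  simp only [pos, shift, cos_add, sin_add]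
  module

lemma shift_shift_neg (e : Ellipse E) (δ : ℝ) : (e.shift δ).shift (-δ) = e := by
  have h := sin_sq_add_cos_sq δ
  have h1 : ∀ r : ℝ, r = (sin δ ^ 2 + cos δ ^ 2) * r := fun r => by rw [h, one_mul]
  have h2 : ∀ r : E, r = (sin δ ^ 2 + cos δ ^ 2) • r := fun r => by rw [h, one_smul]
  ext
  · rfl
  · simp only [shift, cos_neg, sin_neg]
    conv_rhs => rw [h1 e.ρ]
    ring
  · simp only [shift, cos_neg, sin_neg]
    conv_rhs => rw [h1 e.σ]
    ring
  · rfl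
  · simp only [shift, cos_neg, sin_neg]
    conv_rhs => rw [h2 e.X]
    module
  · simp only [shift, cos_neg, sin_neg]
    conv_rhs => rw [h2 e.Y]
    module

lemma continuous_pos (e : Ellipse E) : Continuous e.pos := by
  unfold pos; fun_prop

omit [NormedAddCommGroup E] [InnerProductSpace ℝ E] in
lemma continuous_time (e : Ellipse E) : Continuous e.time := by
  unfold time; fun_prop

lemma hasDerivAt_pos (e : Ellipse E) (u : ℝ) : HasDerivAt e.pos (e.vel u) u := by
  have h := (((hasDerivAt_cos u).smul_const e.X).const_add e.c).add
    ((hasDerivAt_sin u).smul_const e.Y)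
  exact h.congr_deriv (by simp [vel])

lemma hasDerivAt_vel (e : Ellipse E) (u : ℝ) : HasDerivAt e.vel (e.c - e.pos u) u := by
  have h := ((hasDerivAt_sin u).smul_const e.X).neg.add ((hasDerivAt_cos u).smul_const e.Y)
  exact h.congr_deriv (by simp only [pos]; module)

omit [NormedAddCommGroup E] [InnerProductSpace ℝ E] in
lemma hasDerivAt_rad (e : Ellipse E) (u : ℝ) : HasDerivAt e.rad (e.radVel u) u := by
  have h := (((hasDerivAt_cos u).const_mul e.ρ).const_add e.a).add
    ((hasDerivAt_sin u).const_mul e.σ)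
  exact h.congr_deriv (by simp only [radVel]; ring)

omit [NormedAddCommGroup E] [InnerProductSpace ℝ E] in
lemma hasDerivAt_time (e : Ellipse E) (u : ℝ) : HasDerivAt e.time (√e.a * e.rad u) u := by
  have h := ((((hasDerivAt_id u).const_mul e.a).add ((hasDerivAt_sin u).const_mul e.ρ)).add
    (((hasDerivAt_cos u).const_sub 1).const_mul e.σ)).const_mul (√e.a)
  exact h.congr_deriv (by simp only [rad]; ring)

omit [NormedAddCommGroup E] [InnerProductSpace ℝ E] in
lemma time_zero (e : Ellipse E) : e.time 0 = 0 := by simp [time]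

lemma pos_add_int_mul_two_pi (e : Ellipse E) (u : ℝ) (k : ℤ) :
    e.pos (u + k * (2 * π)) = e.pos u := by simp [pos]

lemma vel_add_int_mul_two_pi (e : Ellipse E) (u : ℝ) (k : ℤ) :
    e.vel (u + k * (2 * π)) = e.vel u := by simp [vel]

omit [NormedAddCommGroup E] [InnerProductSpace ℝ E] in
lemma sq_rad_sub_add_sq (e : Ellipse E) (u : ℝ) : (e.rad u - e.a) ^ 2 + e.radVel u ^ 2 = e.ρ ^ 2 + e.σ ^ 2 := by
  unfold rad radVel
  linear_combination (e.ρ ^ 2 + e.σ ^ 2) * sin_sq_add_cos_sq u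

namespace IsKeplerian

variable {e : Ellipse E} (h : e.IsKeplerian)
include h

lemma shift (δ : ℝ) : (e.shift δ).IsKeplerian := by
  have hs := sin_sq_add_cos_sq δ
  have h1 := h.inner_X_X
  have h2 := h.inner_Y_Y
  have h3 := h.inner_X_Y
  have h4 := h3
  rw [real_inner_comm] at h4
  refine ⟨h.a_pos, ?_, ?_, ?_, ?_, ?_⟩
  · simp only [Ellipse.shift, inner_add_left, inner_add_right, real_inner_smul_left,
      real_inner_smul_right, h1, h2, h3, h4]
    linear_combination e.a ^ 2 * hs
  · simp only [Ellipse.shift, inner_add_left, inner_add_right, real_inner_smul_left,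
      real_inner_smul_right, inner_neg_left, inner_neg_right, h1, h2, h3, h4]
    linear_combination e.a ^ 2 * hs
  · simp only [Ellipse.shift, inner_add_left, inner_add_right, real_inner_smul_left,
      real_inner_smul_right, inner_neg_right, h1, h2, h3, h4]
    ring
  · have : e.a • e.c = (sin δ ^ 2 + cos δ ^ 2) • (e.ρ • e.X + e.σ • e.Y) := by
      rw [hs, one_smul, h.center]
    simp only [Ellipse.shift, this]
    module
  · have := h.le
    simp only [Ellipse.shift]
    nlinarith

lemma inner_c_X : inner ℝ e.c e.X = e.a * e.ρ := by
  have h1 := congrArg (inner ℝ · e.X) h.center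
  have h2 := h.inner_X_Y
  rw [real_inner_comm] at h2
  simp only [inner_add_left, real_inner_smul_left, h.inner_X_X, h2] at h1
  have := h.a_pos.ne'
  apply mul_left_cancel₀ this
  rw [h1]
  ring

lemma inner_c_Y : inner ℝ e.c e.Y = e.a * e.σ := by
  have h1 := congrArg (inner ℝ · e.Y) h.center
  simp only [inner_add_left, real_inner_smul_left, h.inner_Y_Y, h.inner_X_Y] at h1
  have := h.a_pos.ne'
  apply mul_left_cancel₀ this
  rw [h1]
  ring

lemma inner_c_c : inner ℝ e.c e.c = e.ρ ^ 2 + e.σ ^ 2 := by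
  have h1 := congrArg (inner ℝ e.c ·) h.center
  simp only [inner_add_right, real_inner_smul_right, h.inner_c_X, h.inner_c_Y] at h1
  have := h.a_pos.ne'
  apply mul_left_cancel₀ this
  rw [h1]
  ring

lemma rad_nonneg (u : ℝ) : 0 ≤ e.rad u := by
  have h1 := sin_sq_add_cos_sq u
  have h2 := h.le
  have h3 : (e.ρ * cos u + e.σ * sin u) ^ 2 ≤ e.a ^ 2 := by
    nlinarith [sq_nonneg (e.ρ * sin u - e.σ * cos u)]
  have := abs_le_of_sq_le_sq' h3 h.a_pos.le
  unfold rad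
  linarith [this.1]

lemma norm_pos (u : ℝ) : ‖e.pos u‖ = e.rad u := by
  rw [← sq_eq_sq₀ (norm_nonneg _) (h.rad_nonneg u), ← real_inner_self_eq_norm_sq]
  have h1 := sin_sq_add_cos_sq u
  have h2 := h.inner_c_X
  have h3 := h.inner_c_Y
  have h4 := h.inner_X_Y
  rw [real_inner_comm] at h2 h3 h4
  simp only [pos, rad, inner_add_left, inner_add_right, real_inner_smul_left,
    real_inner_smul_right, h2, h3, h4, h.inner_X_X, h.inner_Y_Y, h.inner_c_c, h.inner_c_X,
    h.inner_c_Y, h.inner_X_Y]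
  linear_combination (e.a ^ 2 - e.ρ ^ 2 - e.σ ^ 2) * h1

/-- Conservation of energy in the anomaly: dividing by `a * rad ^ 2` gives the squared speed `2 /
rad - 1 / a`. -/
lemma inner_vel_vel (u : ℝ) : inner ℝ (e.vel u) (e.vel u) = 2 * e.a * e.rad u - e.rad u ^ 2 := by
  have h1 := sin_sq_add_cos_sq u
  have h4 := h.inner_X_Y
  rw [real_inner_comm] at h4
  simp only [vel, rad, inner_add_left, inner_add_right, real_inner_smul_left, inner_neg_left,
    inner_neg_right, real_inner_smul_right, h4, h.inner_X_X, h.inner_Y_Y, h.inner_X_Y]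
  linear_combination e.a ^ 2 * h1

lemma inner_pos_vel (u : ℝ) : inner ℝ (e.pos u) (e.vel u) = e.rad u * e.radVel u := by
  have h2 := h.inner_c_X
  have h3 := h.inner_c_Y
  have h4 := h.inner_X_Y
  rw [real_inner_comm] at h4
  simp only [pos, vel, rad, radVel, inner_add_left, inner_add_right, real_inner_smul_left,
    inner_neg_right, real_inner_smul_right, h2, h3, h4, h.inner_X_X, h.inner_Y_Y,
    h.inner_X_Y]
  ring

/-- This is Newton's equation with the eccentric anomaly as independent variable. -/
lemma rad_smul_pos_sub (u : ℝ) :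
    e.rad u • (e.pos u - e.c) = e.a • e.pos u - e.radVel u • e.vel u := by
  have h1 : e.a • e.c = (sin u ^ 2 + cos u ^ 2) • (e.ρ • e.X + e.σ • e.Y) := by
    rw [sin_sq_add_cos_sq, one_smul, h.center]
  simp only [pos, rad, radVel, vel, smul_add e.a, h1]
  module

/-- The derivative `√a * rad` vanishes at collisions, so increments are compared directly: `time (w
+ d) - time (w - d)` equals `2 √a (a d + (ρ cos w + σ sin w) sin d)`, and `|sin d| < d`. -/
lemma strictMono_time : StrictMono e.time := by
  intro u v huv
  obtain ⟨w, d, rfl, rfl⟩ : ∃ w d, u = w - d ∧ v = w + d :=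
    ⟨(u + v) / 2, (v - u) / 2, by ring, by ring⟩
  have hd : 0 < d := by linarith
  have ha := h.a_pos
  refine mul_lt_mul_of_pos_left ?_ (Real.sqrt_pos.2 ha)
  rw [sin_add, sin_sub, cos_add, cos_sub, ← sub_pos]
  have h1 := sin_sq_add_cos_sq w
  have h2 := h.le
  have h3 : (e.ρ * cos w + e.σ * sin w) ^ 2 ≤ e.a ^ 2 := by
    nlinarith [sq_nonneg (e.ρ * sin w - e.σ * cos w)]
  have h3 := abs_le_of_sq_le_sq h3 ha.le
  have h4 : |sin d| < d := (abs_sin_lt_abs hd.ne').trans_eq (abs_of_pos hd)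
  have h5 : |(e.ρ * cos w + e.σ * sin w) * sin d| < e.a * d := by
    rw [abs_mul]
    calc _ ≤ e.a * |sin d| := by gcongr
      _ < _ := by gcongr
  have h6 := (abs_lt.1 h5).1
  linarith

/-- Up to the factor `√a`, the time differs from `a * u` by a bounded function. -/
lemma surjective_time : Function.Surjective e.time := by
  have ha := h.a_pos
  have hb : ∀ u, |e.ρ * sin u + e.σ * (1 - cos u)| ≤ |e.ρ| + |e.σ| * 2 := by
    intro u
    refine (abs_add_le _ _).trans ?_
    rw [abs_mul, abs_mul]
    have h1 := abs_sin_le_one u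
    have h2 : |1 - cos u| ≤ 2 := abs_le.2 ⟨by linarith [cos_le_one u], by linarith [neg_one_le_cos u]⟩
    have := abs_nonneg e.ρ
    gcongr
    nlinarith
  have hs := Real.sqrt_pos.2 ha
  refine e.continuous_time.surjective ?_ ?_
  · refine Tendsto.const_mul_atTop hs ?_
    refine tendsto_atTop_mono (f := fun u => e.a * u + -(|e.ρ| + |e.σ| * 2)) (fun u => ?_)
      (tendsto_atTop_add_const_right _ _ (tendsto_id.const_mul_atTop ha))
    have := (abs_le.1 (hb u)).1
    linarith
  · refine Tendsto.const_mul_atBot hs ?_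
    refine tendsto_atBot_mono (f := fun u => e.a * u + (|e.ρ| + |e.σ| * 2)) (fun u => ?_)
      (tendsto_atBot_add_const_right _ _ (tendsto_id.const_mul_atBot ha))
    have := (abs_le.1 (hb u)).2
    linarith

/-- On an ellipse through the origin, the motion is rectilinear. -/
lemma pos_eq_smul_of_rad_eq_zero {u₀ : ℝ} (h0 : e.rad u₀ = 0) (u : ℝ) :
    e.pos u = (e.rad u / e.a) • e.c := by
  have ha := h.a_pos
  have hle := h.le
  have h1 := e.sq_rad_sub_add_sq u₀
  rw [h0] at h1
  -- A zero of `rad` forces eccentricity one; then `X - (ρ / a) c` and `Y - (σ / a) c` have norm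
  -- zero.
  have h2 : e.ρ ^ 2 + e.σ ^ 2 = e.a ^ 2 := le_antisymm hle (by nlinarith [sq_nonneg (e.radVel u₀)])
  have hX : e.X = (e.ρ / e.a) • e.c := by
    have h3 := h.inner_c_X
    rw [real_inner_comm] at h3
    rw [← sub_eq_zero, ← inner_self_eq_zero (𝕜 := ℝ)]
    simp only [inner_sub_left, inner_sub_right, real_inner_smul_left, real_inner_smul_right,
      h.inner_c_X, h3, h.inner_X_X, h.inner_c_c, h2]
    field_simp
    linear_combination -h2
  have hY : e.Y = (e.σ / e.a) • e.c := by
    have h3 := h.inner_c_Y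
    rw [real_inner_comm] at h3
    rw [← sub_eq_zero, ← inner_self_eq_zero (𝕜 := ℝ)]
    simp only [inner_sub_left, inner_sub_right, real_inner_smul_left, real_inner_smul_right,
      h.inner_c_Y, h3, h.inner_Y_Y, h.inner_c_c, h2]
    field_simp
    linear_combination -h2
  have hc : e.c = (e.a / e.a) • e.c := by rw [div_self ha.ne', one_smul]
  simp only [pos, rad]
  rw [hX, hY]
  nth_rw 1 [hc]
  module

/-- At a zero of `rad`, `(ρ + a cos) ^ 2 + (σ + a sin) ^ 2 = ρ ^ 2 + σ ^ 2 - a ^ 2 ≤ 0`, which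
determines the cosine and the sine. -/
lemma eq_add_int_mul_of_rad_eq_zero {u v : ℝ} (hu : e.rad u = 0) (hv : e.rad v = 0) :
    ∃ k : ℤ, v = u + k * (2 * π) := by
  have ha := h.a_pos
  have key : ∀ z, e.rad z = 0 → e.ρ + e.a * cos z = 0 ∧ e.σ + e.a * sin z = 0 := by
    intro z hz
    have h1 := sin_sq_add_cos_sq z
    have h2 : (e.ρ + e.a * cos z) ^ 2 + (e.σ + e.a * sin z) ^ 2 ≤ 0 := by
      have h3 := h.le
      unfold rad at hz
      nlinarith
    constructor <;> nlinarith [sq_nonneg (e.ρ + e.a * cos z), sq_nonneg (e.σ + e.a * sin z)]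
  obtain ⟨h1, h2⟩ := key u hu
  obtain ⟨h3, h4⟩ := key v hv
  have hc : cos v = cos u := mul_left_cancel₀ ha.ne' (by linarith)
  have hs : sin v = sin u := mul_left_cancel₀ ha.ne' (by linarith)
  obtain ⟨k, hk⟩ := Real.Angle.angle_eq_iff_two_pi_dvd_sub.1 (Real.Angle.cos_sin_inj hc hs)
  exact ⟨k, by linarith⟩

end IsKeplerian

end Ellipse

end KeplerLambert

/-! ### Lambert's problem: the ellipse through two points with a given increment of anomaly. -/

namespace KeplerLambert
open Real Set Filter Topology

section Lambert

variable {E : Type*} [NormedAddCommGroup E] [InnerProductSpace ℝ E]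

/-- The mean distance of two points to the origin. -/
noncomputable def meanRad (A B : E) : ℝ := (‖A‖ + ‖B‖) / 2

/-- The geometric mean of the distances of two points to the origin times the cosine of half the
angle under which they are seen. -/
noncomputable def lambertInv (A B : E) : ℝ := √((‖A‖ * ‖B‖ + inner ℝ A B) / 2)

/-- A vector on the bisector of two vectors. -/
noncomputable def bisector (A B : E) : E := (2 * lambertInv A B)⁻¹ • (‖B‖ • A + ‖A‖ • B)

/-- The Keplerian ellipse through `A` and `B`, at the eccentric anomalies `-δ` and `δ`, such that
the arc in between is direct. -/
noncomputable def lambertEllipse (A B : E) (δ : ℝ) : Ellipse E where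
  a := semiMajor (meanRad A B) (lambertInv A B) δ
  ρ := (lambertInv A B - meanRad A B * cos δ) / sin δ ^ 2
  σ := (‖B‖ - ‖A‖) / (2 * sin δ)
  c := (sin δ ^ 2)⁻¹ • ((2 : ℝ)⁻¹ • (A + B) - cos δ • bisector A B)
  X := (sin δ ^ 2)⁻¹ • (bisector A B - cos δ • (2 : ℝ)⁻¹ • (A + B))
  Y := (2 * sin δ)⁻¹ • (B - A)

variable {A B : E}

lemma ne_zero_left_of_zero_notMem_segment (h0 : (0 : E) ∉ segment ℝ A B) : A ≠ 0 := by
  rintro rfl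
  exact h0 (left_mem_segment ℝ _ _)

lemma ne_zero_right_of_zero_notMem_segment (h0 : (0 : E) ∉ segment ℝ A B) : B ≠ 0 := by
  rintro rfl
  exact h0 (right_mem_segment ℝ _ _)

/-- Equality in Cauchy–Schwarz with the negative sign would make `A` and `B` opposite, with the
origin between them. -/
lemma norm_mul_norm_add_inner_pos (h0 : (0 : E) ∉ segment ℝ A B) :
    0 < ‖A‖ * ‖B‖ + inner ℝ A B := by
  have hA := norm_pos_iff.2 (ne_zero_left_of_zero_notMem_segment h0)
  have hB := norm_pos_iff.2 (ne_zero_right_of_zero_notMem_segment h0)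
  have h1 := neg_le_of_abs_le (abs_real_inner_le_norm A B)
  rcases h1.lt_or_eq with h | h
  · linarith
  · have h2 : inner ℝ A (-B) = ‖A‖ * ‖-B‖ := by rw [inner_neg_right, norm_neg, ← h, neg_neg]
    rw [inner_eq_norm_mul_iff_real, norm_neg, smul_neg] at h2
    refine absurd ?_ h0
    refine ⟨‖B‖ / (‖A‖ + ‖B‖), ‖A‖ / (‖A‖ + ‖B‖), by positivity, by positivity, by field_simp; ring,
      ?_⟩
    rw [div_eq_inv_mul, div_eq_inv_mul, mul_smul, mul_smul, h2]
    simp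

lemma lambertInv_pos (h0 : (0 : E) ∉ segment ℝ A B) : 0 < lambertInv A B :=
  Real.sqrt_pos.2 (half_pos (norm_mul_norm_add_inner_pos h0))

lemma inner_eq_two_mul_lambertInv_sq_sub (h0 : (0 : E) ∉ segment ℝ A B) :
    inner ℝ A B = 2 * lambertInv A B ^ 2 - ‖A‖ * ‖B‖ := by
  rw [lambertInv, Real.sq_sqrt (half_pos (norm_mul_norm_add_inner_pos h0)).le]
  ring

/-- The chord satisfies `‖A - B‖ ^ 2 = 4 (R ^ 2 - κ ^ 2)`. -/
lemma lambertInv_lt_meanRad (h0 : (0 : E) ∉ segment ℝ A B) (hAB : A ≠ B) :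
    lambertInv A B < meanRad A B := by
  have h1 := inner_eq_two_mul_lambertInv_sq_sub h0
  have h2 := norm_sub_sq_real A B
  have h3 : 0 < ‖A - B‖ ^ 2 := pow_pos (norm_pos_iff.2 (sub_ne_zero.2 hAB)) 2
  refine lt_of_pow_lt_pow_left₀ 2 (by unfold meanRad; positivity) ?_
  unfold meanRad
  nlinarith

lemma lambertInv_sq_le (h0 : (0 : E) ∉ segment ℝ A B) : lambertInv A B ^ 2 ≤ ‖A‖ * ‖B‖ := by
  have h1 := inner_eq_two_mul_lambertInv_sq_sub h0
  have h2 := real_inner_le_norm A B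
  linarith

lemma inner_bisector_left (h0 : (0 : E) ∉ segment ℝ A B) :
    inner ℝ (bisector A B) A = lambertInv A B * ‖A‖ := by
  have h1 := inner_eq_two_mul_lambertInv_sq_sub h0
  have h2 := (lambertInv_pos h0).ne'
  rw [real_inner_comm] at h1
  rw [bisector, real_inner_smul_left, inner_add_left, real_inner_smul_left, real_inner_smul_left,
    real_inner_self_eq_norm_sq, h1]
  field_simp
  ring

lemma inner_bisector_right (h0 : (0 : E) ∉ segment ℝ A B) :
    inner ℝ (bisector A B) B = lambertInv A B * ‖B‖ := by
  have h1 := inner_eq_two_mul_lambertInv_sq_sub h0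
  have h2 := (lambertInv_pos h0).ne'
  rw [bisector, real_inner_smul_left, inner_add_left, real_inner_smul_left, real_inner_smul_left,
    real_inner_self_eq_norm_sq, h1]
  field_simp
  ring

lemma inner_bisector_self (h0 : (0 : E) ∉ segment ℝ A B) :
    inner ℝ (bisector A B) (bisector A B) = ‖A‖ * ‖B‖ := by
  have h2 := (lambertInv_pos h0).ne'
  nth_rw 2 [bisector]
  rw [real_inner_smul_right, inner_add_right, real_inner_smul_right, real_inner_smul_right,
    inner_bisector_left h0, inner_bisector_right h0]
  field_simp
  ring

lemma inv_sin_sq_mul {x : ℝ} (hs : sin x ≠ 0) : (sin x ^ 2)⁻¹ * (1 - cos x ^ 2) = 1 := by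
  rw [← sin_sq, inv_mul_cancel₀ (pow_ne_zero 2 hs)]

lemma lambertEllipse_pos_neg {δ : ℝ} (hs : sin δ ≠ 0) : (lambertEllipse A B δ).pos (-δ) = A := by
  have hsc := sin_sq_add_cos_sq δ
  have h1 : (sin δ ^ 2)⁻¹ * (1 - cos δ ^ 2) = 1 := inv_sin_sq_mul hs
  have h2 : sin δ * (2 * sin δ)⁻¹ = 2⁻¹ := by field_simp
  simp only [Ellipse.pos, lambertEllipse, cos_neg, sin_neg]
  calc _ = ((sin δ ^ 2)⁻¹ * (1 - cos δ ^ 2)) • (2 : ℝ)⁻¹ • (A + B) -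
        (sin δ * (2 * sin δ)⁻¹) • (B - A) := by module
    _ = A := by rw [h1, h2]; module

lemma lambertEllipse_pos {δ : ℝ} (hs : sin δ ≠ 0) : (lambertEllipse A B δ).pos δ = B := by
  have hsc := sin_sq_add_cos_sq δ
  have h1 : (sin δ ^ 2)⁻¹ * (1 - cos δ ^ 2) = 1 := inv_sin_sq_mul hs
  have h2 : sin δ * (2 * sin δ)⁻¹ = 2⁻¹ := by field_simp
  simp only [Ellipse.pos, lambertEllipse]
  calc _ = ((sin δ ^ 2)⁻¹ * (1 - cos δ ^ 2)) • (2 : ℝ)⁻¹ • (A + B) +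
        (sin δ * (2 * sin δ)⁻¹) • (B - A) := by module
    _ = B := by rw [h1, h2]; module

lemma isKeplerian_lambertEllipse (h0 : (0 : E) ∉ segment ℝ A B) (hAB : A ≠ B) {δ : ℝ}
    (hδ : δ ∈ Ioo 0 π) : (lambertEllipse A B δ).IsKeplerian := by
  have hκ := lambertInv_pos h0
  have hR := lambertInv_lt_meanRad h0 hAB
  have hs := (sin_pos_of_mem_Ioo hδ).ne'
  have hsc := sin_sq_add_cos_sq δ
  have hAB := inner_eq_two_mul_lambertInv_sq_sub h0
  have hBA := hAB
  rw [real_inner_comm] at hBA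
  have hAA := real_inner_self_eq_norm_sq A
  have hBB := real_inner_self_eq_norm_sq B
  have hKA := inner_bisector_left h0
  have hKB := inner_bisector_right h0
  have hAK := hKA
  have hBK := hKB
  rw [real_inner_comm] at hAK hBK
  have hKK := inner_bisector_self h0
  refine ⟨semiMajor_pos hκ hR hδ, ?_, ?_, ?_, ?_, ?_⟩
  · simp only [lambertEllipse, semiMajor, meanRad, inner_sub_left, inner_sub_right,
      inner_add_left, inner_add_right, real_inner_smul_left, real_inner_smul_right, hAB, hBA, hAA,
      hBB, hKA, hKB, hAK, hBK, hKK]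
    field_simp
    linear_combination (‖B‖ - ‖A‖) ^ 2 * hsc
  · simp only [lambertEllipse, semiMajor, meanRad, inner_sub_left, inner_sub_right,
      real_inner_smul_left, real_inner_smul_right, hAB, hBA, hAA, hBB]
    field_simp
    linear_combination ((‖B‖ + ‖A‖) ^ 2 - 4 * lambertInv A B ^ 2) * hsc
  · simp only [lambertEllipse, semiMajor, meanRad, inner_sub_left, inner_sub_right,
      inner_add_left, real_inner_smul_left, real_inner_smul_right, hAB, hBA, hAA,
      hBB, hKA, hKB]
    field_simp
    ring
  -- The only relation between `A`, `B` and the bisector needed for the center; the rest is linear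
  -- algebra with `sin ^ 2 + cos ^ 2 = 1`.
  · have h1 : meanRad A B • (2 : ℝ)⁻¹ • (A + B) = lambertInv A B • bisector A B +
        ((‖B‖ - ‖A‖) / 4) • (B - A) := by
      have : lambertInv A B * (2 * lambertInv A B)⁻¹ = 2⁻¹ := by field_simp
      rw [bisector, smul_smul (lambertInv A B), this, meanRad]
      module
    set M : E := (2 : ℝ)⁻¹ • (A + B) with hM
    simp only [lambertEllipse, semiMajor, ← hM]
    set K := bisector A B
    set R := meanRad A B
    set κ := lambertInv A B
    clear_value K R κ
    have h2 : (‖B‖ - ‖A‖) / (2 * sin δ) * (2 * sin δ)⁻¹ = (sin δ ^ 2)⁻¹ * ((‖B‖ - ‖A‖) / 4) := by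
      field_simp
      ring
    rw [smul_smul ((‖B‖ - ‖A‖) / (2 * sin δ)), h2, mul_smul (sin δ ^ 2)⁻¹ ((‖B‖ - ‖A‖) / 4),
      ← sub_eq_of_eq_add' h1]
    have h3 : (sin δ ^ 2)⁻¹ * (1 - cos δ ^ 2) = 1 := inv_sin_sq_mul hs
    have h4 : R • M - κ • K = ((sin δ ^ 2)⁻¹ * (1 - cos δ ^ 2)) • (R • M - κ • K) := by
      rw [h3, one_smul]
    rw [h4]
    module
  · have h1 := lambertInv_sq_le h0
    simp only [lambertEllipse, semiMajor, meanRad]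
    -- The quantity `a ^ 2 - ρ ^ 2 - σ ^ 2` is the squared semi-minor axis; it vanishes exactly when
    -- `κ ^ 2 = ‖A‖ ‖B‖`, that is, for `A` and `B` on one ray.
    have h2 : (((‖A‖ + ‖B‖) / 2 - lambertInv A B * cos δ) / sin δ ^ 2) ^ 2 -
        (((lambertInv A B - (‖A‖ + ‖B‖) / 2 * cos δ) / sin δ ^ 2) ^ 2 +
          ((‖B‖ - ‖A‖) / (2 * sin δ)) ^ 2) =
        (‖A‖ * ‖B‖ - lambertInv A B ^ 2) / sin δ ^ 2 := by
      field_simp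
      linear_combination (4 * lambertInv A B ^ 2 - (‖A‖ + ‖B‖) ^ 2) * hsc
    have h3 : 0 ≤ (‖A‖ * ‖B‖ - lambertInv A B ^ 2) / sin δ ^ 2 :=
      div_nonneg (sub_nonneg.2 h1) (sq_nonneg _)
    linarith

/-- The arc as a rational quadratic Bézier curve. When `cos (p + q) ≠ 0`, the third vector is
proportional to the point where the tangents at the two ends meet. For `p, q ∈ [0, π]` all
coefficients are nonnegative. -/
lemma Ellipse.pos_eq_combination (e : Ellipse E) {p q : ℝ} (hs : sin (p + q) ≠ 0) :
    e.pos (p - q) = (sin (p + q) ^ 2)⁻¹ • (sin q ^ 2 • e.pos (-(p + q)) + sin p ^ 2 • e.pos (p + q) +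
      (2 * sin p * sin q) • (cos (p + q) • e.c + e.X)) := by
  rw [eq_inv_smul_iff₀ (pow_ne_zero 2 hs)]
  have hp := sin_sq_add_cos_sq p
  have hq := sin_sq_add_cos_sq q
  have hc : sin (p + q) ^ 2 = sin q ^ 2 + sin p ^ 2 + 2 * sin p * sin q * cos (p + q) := by
    rw [sin_add, cos_add]
    linear_combination sin p ^ 2 * hq + sin q ^ 2 * hp
  have hX : sin (p + q) ^ 2 * cos (p - q) = cos (p + q) * (sin q ^ 2 + sin p ^ 2) +
      2 * sin p * sin q := by
    have h1 : cos (p - q) = cos (p + q) + 2 * sin p * sin q := by rw [cos_sub, cos_add]; ring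
    rw [h1, sin_sq]
    rw [sin_sq] at hc
    linear_combination cos (p + q) * hc
  have hY : sin (p + q) ^ 2 * sin (p - q) = sin (p + q) * (sin p ^ 2 - sin q ^ 2) := by
    have h1 : sin (p + q) * sin (p - q) = sin p ^ 2 - sin q ^ 2 := by
      rw [sin_add, sin_sub]
      linear_combination sin p ^ 2 * hq - sin q ^ 2 * hp
    rw [← h1]
    ring
  simp only [pos, smul_add, smul_smul, hX, hY, cos_neg, sin_neg]
  rw [hc]
  module

/-- For this ellipse the third vector of `Ellipse.pos_eq_combination` is the bisector, so the whole
arc lies in the open half-space where the inner product with the bisector is positive. -/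
lemma zero_notMem_convexHull_lambertEllipse (h0 : (0 : E) ∉ segment ℝ A B) {δ : ℝ}
    (hδ : δ ∈ Ioo 0 π) :
    (0 : E) ∉ convexHull ℝ ((lambertEllipse A B δ).pos '' Icc (-δ) δ) := by
  have hs := sin_pos_of_mem_Ioo hδ
  have hA := norm_pos_iff.2 (ne_zero_left_of_zero_notMem_segment h0)
  have hB := norm_pos_iff.2 (ne_zero_right_of_zero_notMem_segment h0)
  have hκ := lambertInv_pos h0
  have hsub : convexHull ℝ ((lambertEllipse A B δ).pos '' Icc (-δ) δ) ⊆
      {x | 0 < inner ℝ (bisector A B) x} := by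
    refine convexHull_min ?_ (convex_halfSpace_gt (innerₛₗ ℝ (bisector A B)).isLinear 0)
    rintro _ ⟨u, hu, rfl⟩
    obtain ⟨p, q, rfl, rfl⟩ : ∃ p q, u = p - q ∧ δ = p + q :=
      ⟨(δ + u) / 2, (δ - u) / 2, by ring, by ring⟩
    have hp0 : 0 ≤ p := by linarith [hu.1]
    have hq0 : 0 ≤ q := by linarith [hu.2]
    have hp : 0 ≤ sin p := sin_nonneg_of_nonneg_of_le_pi hp0 (by linarith [hδ.2])
    have hq : 0 ≤ sin q := sin_nonneg_of_nonneg_of_le_pi hq0 (by linarith [hδ.2])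
    have hsc := sin_sq_add_cos_sq (p + q)
    have hK : cos (p + q) • (lambertEllipse A B (p + q)).c + (lambertEllipse A B (p + q)).X =
        bisector A B := by
      have h1 : (sin (p + q) ^ 2)⁻¹ * (1 - cos (p + q) ^ 2) = 1 := inv_sin_sq_mul hs.ne'
      calc _ = ((sin (p + q) ^ 2)⁻¹ * (1 - cos (p + q) ^ 2)) • bisector A B := by
            simp only [lambertEllipse]
            module
        _ = _ := by rw [h1, one_smul]
    rw [Ellipse.pos_eq_combination _ hs.ne', lambertEllipse_pos_neg hs.ne',
      lambertEllipse_pos hs.ne', hK]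
    change 0 < inner ℝ _ _
    rw [real_inner_smul_right, inner_add_right, inner_add_right, real_inner_smul_right,
      real_inner_smul_right, real_inner_smul_right, inner_bisector_left h0, inner_bisector_right h0,
      inner_bisector_self h0]
    refine mul_pos (by positivity) ?_
    have h1 : 0 < sin p ∨ 0 < sin q := by
      by_contra! h
      have hp1 := le_antisymm h.1 hp
      have hq1 := le_antisymm h.2 hq
      rw [sin_add, hp1, hq1] at hs
      simp at hs
    rcases h1 with h | h <;> positivity
  intro h
  have h1 : 0 < inner ℝ (bisector A B) (0 : E) := hsub h
  simp at h1

/-- Lambert's problem: a Keplerian ellipse is determined by two of its points, the difference of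
their eccentric anomalies, and the directness of the arc. -/
theorem eq_lambertEllipse (h0 : (0 : E) ∉ segment ℝ A B) {δ : ℝ}
    (hδ : δ ∈ Ioo 0 π) {e : Ellipse E} (he : e.IsKeplerian) (hA : e.pos (-δ) = A)
    (hB : e.pos δ = B) (hd : (0 : E) ∉ convexHull ℝ (e.pos '' Icc (-δ) δ)) :
    e = lambertEllipse A B δ := by
  have hs := sin_pos_of_mem_Ioo hδ
  have hsc := sin_sq_add_cos_sq δ
  have hA0 := norm_pos_iff.2 (ne_zero_left_of_zero_notMem_segment h0)
  have hκ := lambertInv_pos h0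
  have hrA : ‖A‖ = e.a + e.ρ * cos δ - e.σ * sin δ := by
    rw [← hA, he.norm_pos, Ellipse.rad, cos_neg, sin_neg]
    ring
  have hrB : ‖B‖ = e.a + e.ρ * cos δ + e.σ * sin δ := by
    rw [← hB, he.norm_pos, Ellipse.rad]
  have hA' : A = e.c + cos δ • e.X - sin δ • e.Y := by
    rw [← hA, Ellipse.pos, cos_neg, sin_neg]
    module
  have hB' : B = e.c + cos δ • e.X + sin δ • e.Y := by rw [← hB, Ellipse.pos]
  set k := e.a * cos δ + e.ρ with hk
  set K := cos δ • e.c + e.X with hK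
  -- Whatever the ellipse, `K` is parallel to the bisector; pairing this identity with `A` then
  -- gives `k = ± κ`.
  have hbis : ‖B‖ • A + ‖A‖ • B = (2 * k) • K := by
    have h1 : e.σ • e.Y = e.a • e.c - e.ρ • e.X := by rw [he.center]; module
    have h2 : ‖B‖ • A + ‖A‖ • B = (2 * (e.a + e.ρ * cos δ)) • (e.c + cos δ • e.X) -
        (2 * sin δ ^ 2) • e.σ • e.Y := by
      rw [hrA, hrB, hA', hB']
      module
    rw [h2, h1, sin_sq, hk, hK]
    module
  have hKA : inner ℝ K A = k * ‖A‖ := by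
    have h2 := he.inner_c_X
    rw [real_inner_comm] at h2
    rw [hrA, hA', hK, hk]
    simp only [inner_add_left, inner_add_right, inner_sub_right, real_inner_smul_left,
      real_inner_smul_right, h2, he.inner_c_X, he.inner_c_Y, he.inner_c_c, he.inner_X_X,
      he.inner_X_Y]
    ring
  have hkκ : k ^ 2 = lambertInv A B ^ 2 := by
    have h1 := congrArg (inner ℝ · A) hbis
    have h2 := inner_eq_two_mul_lambertInv_sq_sub h0
    rw [real_inner_comm] at h2
    simp only [inner_add_left, real_inner_smul_left, real_inner_self_eq_norm_sq, h2, hKA] at h1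
    refine mul_left_cancel₀ (mul_pos two_pos hA0).ne' ?_
    linear_combination -h1
  rcases sq_eq_sq_iff_eq_or_eq_neg.1 hkκ with hkk | hkk
  -- With `k = κ`, the coefficients solve a linear system of determinant `sin δ ^ 2`.
  · have hKK : K = bisector A B := by
      rw [bisector, hbis, hkk, inv_smul_smul₀ (by positivity)]
    have hM : (2 : ℝ)⁻¹ • (A + B) = e.c + cos δ • e.X := by
      rw [hA', hB']
      module
    have hR : meanRad A B = e.a + e.ρ * cos δ := by
      rw [meanRad, hrA, hrB]
      ring
    have h1 : (sin δ ^ 2)⁻¹ * (1 - cos δ ^ 2) = 1 := inv_sin_sq_mul hs.ne'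
    ext
    · simp only [lambertEllipse, semiMajor]
      rw [hR, ← hkk, hk, eq_div_iff (pow_pos hs 2).ne']
      linear_combination e.a * hsc
    · simp only [lambertEllipse]
      rw [hR, ← hkk, hk, eq_div_iff (pow_pos hs 2).ne']
      linear_combination e.ρ * hsc
    · simp only [lambertEllipse]
      rw [hrA, hrB]
      field_simp
      ring
    · simp only [lambertEllipse]
      rw [hM, ← hKK, hK]
      calc e.c = ((sin δ ^ 2)⁻¹ * (1 - cos δ ^ 2)) • e.c := by rw [h1, one_smul]
        _ = _ := by module
    · simp only [lambertEllipse]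
      rw [hM, ← hKK, hK]
      calc e.X = ((sin δ ^ 2)⁻¹ * (1 - cos δ ^ 2)) • e.X := by rw [h1, one_smul]
        _ = _ := by module
    · simp only [lambertEllipse]
      rw [eq_inv_smul_iff₀ (by positivity), hA', hB']
      module
  · exfalso
    have hKK : K = -bisector A B := by
      rw [bisector, hbis, hkk, show (2 * -lambertInv A B) • K = (2 * lambertInv A B) • (-K) by module,
        inv_smul_smul₀ (by positivity), neg_neg]
    -- With `k = -κ` the arc goes round the origin. This choice of `u` cancels the coefficient of
    -- `B` in `Ellipse.pos_eq_combination`, so the point is `-μ A`, and `0 ≤ μ` because `κ ^ 2 ≤ ‖A‖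
    -- ‖B‖`.
    obtain ⟨u, hu, hu0⟩ : ∃ u ∈ Icc (-δ) δ,
        lambertInv A B * sin ((δ + u) / 2) - ‖A‖ * sin ((δ - u) / 2) = 0 := by
      refine intermediate_value_Icc (by linarith [hδ.1]) (by fun_prop) ⟨?_, ?_⟩
      · have : (δ - -δ) / 2 = δ := by ring
        rw [this]
        simp only [add_neg_cancel, zero_div, sin_zero, mul_zero, zero_sub]
        exact neg_nonpos.2 (by positivity)
      · simp only [sub_self, zero_div, sin_zero, mul_zero, sub_zero, add_self_div_two]
        positivity
    obtain ⟨p, q, rfl, rfl⟩ : ∃ p q, u = p - q ∧ δ = p + q :=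
      ⟨(δ + u) / 2, (δ - u) / 2, by ring, by ring⟩
    rw [show (p + q + (p - q)) / 2 = p by ring, show (p + q - (p - q)) / 2 = q by ring] at hu0
    have hpq : sin p = ‖A‖ * sin q / lambertInv A B := by
      rw [eq_div_iff hκ.ne']
      linarith
    have hpos := e.pos_eq_combination hs.ne'
    rw [← hK, hKK, hA, hB, bisector, hpq] at hpos
    set κ := lambertInv A B with hκd
    have hμ : 0 ≤ (sin (p + q) ^ 2)⁻¹ * sin q ^ 2 * (‖A‖ * ‖B‖ / κ ^ 2 - 1) := by
      have := lambertInv_sq_le h0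
      refine mul_nonneg (by positivity) (sub_nonneg.2 ?_)
      rwa [one_le_div (by positivity)]
    set μ := (sin (p + q) ^ 2)⁻¹ * sin q ^ 2 * (‖A‖ * ‖B‖ / κ ^ 2 - 1) with hμd
    have hposμ : e.pos (p - q) = -(μ • A) := by
      rw [hpos, hμd]
      have h1 : 2 * (‖A‖ * sin q / κ) * sin q * (2 * κ)⁻¹ = sin q ^ 2 * (‖A‖ / κ ^ 2) := by
        field_simp
      have h2 : (2 * (‖A‖ * sin q / κ) * sin q) • -((2 * κ)⁻¹ • (‖B‖ • A + ‖A‖ • B)) =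
          -((2 * (‖A‖ * sin q / κ) * sin q * (2 * κ)⁻¹) • (‖B‖ • A + ‖A‖ • B)) := by
        module
      have h3 : (‖A‖ * sin q / κ) ^ 2 = sin q ^ 2 * (‖A‖ / κ ^ 2) * ‖A‖ := by
        field_simp
      have h4 : ‖A‖ * ‖B‖ / κ ^ 2 = ‖A‖ / κ ^ 2 * ‖B‖ := by ring
      rw [h2, h1, h3, h4]
      module
    refine hd ?_
    have hm1 : A ∈ convexHull ℝ (e.pos '' Icc (-(p + q)) (p + q)) :=
      subset_convexHull ℝ _ ⟨-(p + q), ⟨le_rfl, by linarith [hδ.1]⟩, hA⟩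
    have hm2 : e.pos (p - q) ∈ convexHull ℝ (e.pos '' Icc (-(p + q)) (p + q)) :=
      subset_convexHull ℝ _ ⟨p - q, hu, rfl⟩
    -- These weights place the origin on the segment from `A` to `-μ A`.
    have := convex_convexHull ℝ (e.pos '' Icc (-(p + q)) (p + q)) hm1 hm2
      (a := μ / (1 + μ)) (b := 1 / (1 + μ)) (by positivity) (by positivity) (by field_simp; ring)
    rw [hposμ] at this
    convert this using 1
    module

/-- Lambert's theorem. The terms in `σ` cancel over an interval symmetric about anomaly zero, and `ρ
= κ - a cos δ`, so the individual distances of `A` and `B` disappear. The shift by `-δ` puts `A` at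
anomaly zero. -/
lemma time_lambertEllipse {δ : ℝ} (hs : sin δ ≠ 0) (n : ℕ) :
    ((lambertEllipse A B δ).shift (-δ)).time (n * (2 * π) + 2 * δ) =
      flightTime (meanRad A B) (lambertInv A B) (n * π) δ := by
  have h1 : sin (n * (2 * π) + 2 * δ) = 2 * sin δ * cos δ := by
    rw [add_comm, sin_add_nat_mul_two_pi, sin_two_mul]
  have h2 : cos (n * (2 * π) + 2 * δ) = 2 * cos δ ^ 2 - 1 := by
    rw [add_comm, cos_add_nat_mul_two_pi, cos_two_mul]
  have hsc := sin_sq_add_cos_sq δ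
  have hρ : (lambertEllipse A B δ).ρ = lambertInv A B - (lambertEllipse A B δ).a * cos δ := by
    simp only [lambertEllipse, semiMajor]
    field_simp
    linear_combination (-lambertInv A B) * hsc
  have ha : semiMajor (meanRad A B) (lambertInv A B) δ = (lambertEllipse A B δ).a := rfl
  rw [flightTime, Ellipse.time, h1, h2, ha]
  rw [eq_sub_iff_add_eq] at hρ
  rw [← hρ]
  simp only [Ellipse.shift, sin_neg, cos_neg]
  set e := lambertEllipse A B δ
  clear_value e
  have h3 : 1 - (2 * cos δ ^ 2 - 1) = 2 * sin δ ^ 2 := by linarith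
  rw [h3]
  linear_combination (2 * √e.a * e.ρ * sin δ) * hsc

end Lambert

end KeplerLambert

/-! ### Motion along a Keplerian ellipse solves the Kepler problem, collisions included. -/

namespace KeplerLambert
open Real Set Filter Topology

namespace Ellipse

/-- The eccentric anomaly as a function of time. -/
noncomputable def anomaly {E : Type*} (e : Ellipse E) : ℝ → ℝ := Function.invFun e.time

namespace IsKeplerian

variable {E : Type*} [NormedAddCommGroup E] [InnerProductSpace ℝ E]
variable {e : Ellipse E} (h : e.IsKeplerian)
include h

lemma time_anomaly (t : ℝ) : e.time (e.anomaly t) = t :=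
  Function.rightInverse_invFun h.surjective_time t

lemma anomaly_time (u : ℝ) : e.anomaly (e.time u) = u :=
  Function.leftInverse_invFun h.strictMono_time.injective u

lemma anomaly_zero : e.anomaly 0 = 0 := by
  simpa [e.time_zero] using h.anomaly_time 0

lemma strictMono_anomaly : StrictMono e.anomaly := by
  intro s t hst
  rwa [← h.strictMono_time.lt_iff_lt, h.time_anomaly, h.time_anomaly]

lemma continuous_anomaly : Continuous e.anomaly :=
  h.strictMono_anomaly.monotone.continuous_of_surjective fun u => ⟨e.time u, h.anomaly_time u⟩

lemma hasDerivAt_anomaly {t : ℝ} (ht : e.rad (e.anomaly t) ≠ 0) :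
    HasDerivAt e.anomaly (√e.a * e.rad (e.anomaly t))⁻¹ t :=
  (e.hasDerivAt_time _).of_local_left_inverse h.continuous_anomaly.continuousAt
    (mul_ne_zero (Real.sqrt_pos.2 h.a_pos).ne' ht) (Eventually.of_forall h.time_anomaly)

/-- Collision anomalies differ by multiples of `2π`, and the anomaly stays bounded on `[0, T]`. -/
lemma finite_collisions (T : ℝ) : {t ∈ Icc 0 T | e.rad (e.anomaly t) = 0}.Finite := by
  rcases {t ∈ Icc 0 T | e.rad (e.anomaly t) = 0}.eq_empty_or_nonempty with h0 | ⟨t₀, ht₀⟩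
  · rw [h0]
    exact finite_empty
  · set u₀ := e.anomaly t₀
    have hfin := (finite_Icc ⌊(0 - u₀) / (2 * π)⌋ ⌈(e.anomaly T - u₀) / (2 * π)⌉).image
      (fun k : ℤ => e.time (u₀ + k * (2 * π)))
    refine hfin.subset ?_
    rintro t ⟨ht, ht0⟩
    obtain ⟨k, hk⟩ := h.eq_add_int_mul_of_rad_eq_zero ht₀.2 ht0
    have h1 : 0 ≤ e.anomaly t := by
      rw [← h.anomaly_zero]
      exact h.strictMono_anomaly.monotone ht.1
    have h2 : e.anomaly t ≤ e.anomaly T := h.strictMono_anomaly.monotone ht.2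
    rw [hk] at h1 h2
    refine ⟨k, ⟨?_, ?_⟩, ?_⟩
    · rw [← @Int.cast_le ℝ]
      refine (Int.floor_le _).trans ?_
      rw [div_le_iff₀ two_pi_pos]
      linarith
    · rw [← @Int.cast_le ℝ]
      refine le_trans ?_ (Int.le_ceil _)
      rw [le_div_iff₀ two_pi_pos]
      linarith
    · simp only
      rw [← hk, h.time_anomaly]

end IsKeplerian

variable {d : ℕ}

/-- The motion `(q, v)` around `O` during `[0, T]` is the Keplerian motion along the ellipse `e`,
with eccentric anomaly `u`. -/
structure IsUniformization (e : Ellipse (Space d)) (O : Space d) (T : ℝ) (q v : ℝ → Space d)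
    (u : ℝ → ℝ) : Prop where
  strictMonoOn : StrictMonoOn u (Icc 0 T)
  continuousOn : ContinuousOn u (Icc 0 T)
  zero : u 0 = 0
  pos : ∀ t ∈ Icc 0 T, q t - O = e.pos (u t)
  vel : ∀ t ∈ Icc 0 T, (√e.a * e.rad (u t)) • v t = e.vel (u t)
  time : ∀ t ∈ Icc 0 T, e.time (u t) = t

/-- The velocity of the Keplerian motion along an ellipse. -/
noncomputable def velocity (e : Ellipse (Space d)) (t : ℝ) : Space d :=
  (√e.a * e.rad (e.anomaly t))⁻¹ • e.vel (e.anomaly t)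

variable {e : Ellipse (Space d)}

lemma IsKeplerian.isUniformization (h : e.IsKeplerian) (O : Space d) (T : ℝ) :
    e.IsUniformization O T (fun t => O + e.pos (e.anomaly t)) e.velocity e.anomaly where
  strictMonoOn := h.strictMono_anomaly.strictMonoOn _
  continuousOn := h.continuous_anomaly.continuousOn
  zero := h.anomaly_zero
  pos t _ := add_sub_cancel_left _ _
  vel t _ := by
    -- At a collision `vel` vanishes by `inner_vel_vel`, so the multiplied form of the velocity
    -- relation still holds.
    rcases eq_or_ne (e.rad (e.anomaly t)) 0 with h0 | h0
    · have h1 := h.inner_vel_vel (e.anomaly t)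
      rw [h0] at h1
      have h2 : e.vel (e.anomaly t) = 0 := by
        rw [← inner_self_eq_zero (𝕜 := ℝ), h1]
        ring
      rw [h0, h2, mul_zero, zero_smul]
    · exact smul_inv_smul₀ (mul_ne_zero (Real.sqrt_pos.2 h.a_pos).ne' h0) _
  time t _ := h.time_anomaly t

lemma IsKeplerian.isKeplerMotion (h : e.IsKeplerian) (O : Space d) (T : ℝ) :
    IsKeplerMotion O 0 T (fun t => O + e.pos (e.anomaly t)) e.velocity := by
  have ha := h.a_pos
  have hq := Real.sqrt_pos.2 ha
  have hne : ∀ t, O + e.pos (e.anomaly t) ≠ O ↔ e.rad (e.anomaly t) ≠ 0 := by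
    intro t
    rw [ne_eq, add_eq_left, ← h.norm_pos, norm_ne_zero_iff]
  refine ⟨?_, ?_, ?_, ?_, ?_, ?_⟩
  · exact (continuous_const.add (e.continuous_pos.comp h.continuous_anomaly)).continuousOn
  · intro t _ ht
    have h1 := h.hasDerivAt_anomaly ((hne t).1 ht)
    exact (((e.hasDerivAt_pos _).scomp t h1).const_add O).hasDerivWithinAt
  · intro t _ ht
    have ht := (hne t).1 ht
    have h1 := h.hasDerivAt_anomaly ht
    have h2 := (((e.hasDerivAt_rad _).comp t h1).const_mul (√e.a)).inv
      (mul_ne_zero hq.ne' ht)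
    have h3 := (h2.smul ((e.hasDerivAt_vel _).scomp t h1))
    refine (h3.congr_deriv ?_).hasDerivWithinAt
    -- The chain rule reduces Newton's equation to this identity, multiplied by `(a r ^ 3)⁻¹`.
    have h4 := h.rad_smul_pos_sub (e.anomaly t)
    simp only [add_sub_cancel_left, h.norm_pos, Function.comp_apply, Pi.inv_apply]
    set r := e.rad (e.anomaly t)
    set p := e.pos (e.anomaly t)
    set w := e.vel (e.anomaly t)
    set b := √e.a with hb
    have hba : e.a = b ^ 2 := (Real.sq_sqrt ha.le).symm
    have h5 : (b ^ 2 * r ^ 3)⁻¹ • (r • (p - e.c)) =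
        (b ^ 2 * r ^ 3)⁻¹ • (e.a • p - e.radVel (e.anomaly t) • w) := by rw [h4]
    have h6 : (b ^ 2 * r ^ 3)⁻¹ * r = (b * r)⁻¹ * (b * r)⁻¹ := by field_simp
    have h7 : (b ^ 2 * r ^ 3)⁻¹ * e.a = (r ^ 3)⁻¹ := by rw [hba]; field_simp
    have h8 : -(b * (e.radVel (e.anomaly t) * (b * r)⁻¹)) / (b * r) ^ 2 =
        -((b ^ 2 * r ^ 3)⁻¹ * e.radVel (e.anomaly t)) := by field_simp
    rw [smul_smul, h6, smul_sub _ (e.a • p), smul_smul _ e.a, h7, smul_smul _ (e.radVel _)] at h5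
    rw [h8, ← sub_eq_zero]
    rw [← sub_eq_zero] at h5
    rw [← neg_eq_zero, ← h5]
    module
  · refine ⟨-1 / (2 * e.a), fun t _ ht => ?_⟩
    have ht := (hne t).1 ht
    have h1 := h.inner_vel_vel (e.anomaly t)
    rw [real_inner_self_eq_norm_sq] at h1
    simp only [velocity, add_sub_cancel_left, h.norm_pos, norm_smul, mul_pow, norm_inv, h1,
      inv_pow, norm_mul, Real.norm_eq_abs, sq_abs, Real.sq_sqrt ha.le]
    field_simp
    ring
  · refine (h.finite_collisions T).subset fun t ht => ⟨ht.1, ?_⟩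
    by_contra h0
    exact (hne t).2 h0 ht.2
  · rintro ⟨t₀, _, ht₀⟩ s _ t _
    have h0 : e.rad (e.anomaly t₀) = 0 := by
      by_contra h0
      exact (hne t₀).2 h0 ht₀
    simp only [add_sub_cancel_left, h.pos_eq_smul_of_rad_eq_zero h0]
    exact ((SameRay.refl e.c).nonneg_smul_left (div_nonneg (h.rad_nonneg _) ha.le)).nonneg_smul_right
      (div_nonneg (h.rad_nonneg _) ha.le)

end Ellipse

end KeplerLambert

/-! ### Return times and directness read on the eccentric anomaly. -/

namespace KeplerLambert
open Real Set Filter Topology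

namespace Ellipse.IsUniformization

variable {d : ℕ} {e : Ellipse (Space d)} {O : Space d} {T : ℝ} {q v : ℝ → Space d} {u : ℝ → ℝ}

lemma returnTimes_eq (hu : e.IsUniformization O T q v u) (he : e.IsKeplerian) (h0 : q 0 ≠ O)
    (hne : q T ≠ q 0) (hT : 0 ≤ T) :
    returnTimes T q v = {t ∈ Ioc 0 T | ∃ k : ℤ, u t = k * (2 * π)} := by
  have hm0 : (0 : ℝ) ∈ Icc 0 T := ⟨le_rfl, hT⟩
  have hmT : T ∈ Icc 0 T := ⟨hT, le_rfl⟩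
  have hp0 := hu.pos 0 hm0
  have hv0 := hu.vel 0 hm0
  rw [hu.zero] at hp0 hv0
  ext t
  refine and_congr_right fun ht => ?_
  have htI := Ioc_subset_Icc_self ht
  have hpt := hu.pos t htI
  have hvt := hu.vel t htI
  constructor
  · rintro ⟨hq, hv⟩
    have h1 : e.pos (u t) = e.pos 0 := by rw [← hpt, ← hp0, hq]
    have h2 : e.vel (u t) = e.vel 0 := by
      rw [← hvt, ← hv0, hv, ← he.norm_pos, ← he.norm_pos, h1]
    -- Together with `h4`, a linear system in `X`, `Y` of determinant `(cos - 1) ^ 2 + sin ^ 2`. If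
    -- that is nonzero then `X = Y = 0`, so the body stands still, contradicting `q T ≠ q 0`.
    have h3 : (cos (u t) - 1) • e.X + sin (u t) • e.Y = 0 := by
      rw [← sub_eq_zero] at h1
      simp only [Ellipse.pos, cos_zero, sin_zero] at h1
      rw [← h1]
      module
    have h4 : -(sin (u t) • e.X) + (cos (u t) - 1) • e.Y = 0 := by
      rw [← sub_eq_zero] at h2
      simp only [Ellipse.vel, cos_zero, sin_zero] at h2
      rw [← h2]
      module
    have hc : cos (u t) = 1 := by
      by_contra hc
      have h5 : (cos (u t) - 1) ^ 2 + sin (u t) ^ 2 ≠ 0 := by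
        have : 0 < (cos (u t) - 1) ^ 2 := by
          have := sub_ne_zero.2 hc
          positivity
        positivity
      have hX : e.X = 0 := by
        refine (smul_eq_zero_iff_right h5).1 ?_
        calc _ = (cos (u t) - 1) • ((cos (u t) - 1) • e.X + sin (u t) • e.Y) -
              sin (u t) • (-(sin (u t) • e.X) + (cos (u t) - 1) • e.Y) := by module
          _ = 0 := by rw [h3, h4, smul_zero, smul_zero, sub_zero]
      have hY : e.Y = 0 := by
        refine (smul_eq_zero_iff_right h5).1 ?_
        calc _ = sin (u t) • ((cos (u t) - 1) • e.X + sin (u t) • e.Y) +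
              (cos (u t) - 1) • (-(sin (u t) • e.X) + (cos (u t) - 1) • e.Y) := by module
          _ = 0 := by rw [h3, h4, smul_zero, smul_zero, add_zero]
      refine hne ?_
      have h6 := hu.pos T hmT
      simp only [Ellipse.pos, hX, hY, smul_zero, add_zero] at h6 hp0
      exact sub_left_injective (h6.trans hp0.symm)
    obtain ⟨k, hk⟩ := (cos_eq_one_iff _).1 hc
    exact ⟨k, hk.symm⟩
  · rintro ⟨k, hk⟩
    have h1 : e.pos (u t) = e.pos 0 := by
      rw [hk, ← zero_add ((k : ℝ) * (2 * π)), e.pos_add_int_mul_two_pi]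
    have h2 : e.vel (u t) = e.vel 0 := by
      rw [hk, ← zero_add ((k : ℝ) * (2 * π)), e.vel_add_int_mul_two_pi]
    have h3 : e.rad (u t) = e.rad 0 := by rw [← he.norm_pos, h1, he.norm_pos]
    refine ⟨sub_left_injective (hpt.trans (h1.trans hp0.symm)), ?_⟩
    rw [h2, h3, ← hv0] at hvt
    refine smul_right_injective _ (mul_ne_zero (Real.sqrt_pos.2 he.a_pos).ne' ?_) hvt
    rw [← he.norm_pos, norm_ne_zero_iff, ← hp0]
    exact sub_ne_zero.2 h0

lemma exists_eq (hu : e.IsUniformization O T q v u) (hT : 0 ≤ T) {w : ℝ} (hw : 0 ≤ w)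
    (hwT : w ≤ u T) : ∃ t ∈ Icc 0 T, u t = w :=
  intermediate_value_Icc hT hu.continuousOn ⟨hu.zero.trans_le hw, hwT⟩

lemma encard_returnTimes (hu : e.IsUniformization O T q v u) (he : e.IsKeplerian) (h0 : q 0 ≠ O)
    (hne : q T ≠ q 0) (hT : 0 ≤ T) {n : ℕ} (hn : n * (2 * π) ≤ u T)
    (hn' : u T < (n + 1) * (2 * π)) : (returnTimes T q v).encard = n := by
  have hm0 : (0 : ℝ) ∈ Icc 0 T := ⟨le_rfl, hT⟩
  have hmT : T ∈ Icc 0 T := ⟨hT, le_rfl⟩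
  have hπ := two_pi_pos
  rw [hu.returnTimes_eq he h0 hne hT]
  -- Since `0` is excluded from the return times, the multiples of `2π` start at `k = 1`.
  have h1 : u '' {t ∈ Ioc 0 T | ∃ k : ℤ, u t = k * (2 * π)} =
      (fun k : ℕ => (k : ℝ) * (2 * π)) '' Icc 1 n := by
    ext w
    constructor
    · rintro ⟨t, ⟨ht, k, hk⟩, rfl⟩
      have htI := Ioc_subset_Icc_self ht
      have h2 : 0 < u t := by
        rw [← hu.zero]
        exact hu.strictMonoOn hm0 htI ht.1
      have h3 : u t ≤ u T := hu.strictMonoOn.monotoneOn htI hmT ht.2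
      rw [hk] at h2 h3
      have h4 : 0 < k := by
        have := pos_of_mul_pos_left h2 hπ.le
        exact_mod_cast this
      have h5 : k < n + 1 := by
        have := lt_of_mul_lt_mul_right (h3.trans_lt hn') hπ.le
        exact_mod_cast this
      lift k to ℕ using h4.le
      exact ⟨k, ⟨by exact_mod_cast h4, by omega⟩, by simpa using hk.symm⟩
    · rintro ⟨k, hk, rfl⟩
      have h2 : (1 : ℝ) ≤ k := by exact_mod_cast hk.1
      have h3 : (k : ℝ) ≤ n := by exact_mod_cast hk.2
      obtain ⟨t, ht, htk⟩ := hu.exists_eq hT (w := k * (2 * π)) (by positivity)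
        (le_trans (by gcongr) hn)
      refine ⟨t, ⟨⟨ht.1.lt_of_ne ?_, ht.2⟩, k, by simpa using htk⟩, htk⟩
      rintro rfl
      rw [hu.zero] at htk
      nlinarith
  have hinj : InjOn u {t ∈ Ioc 0 T | ∃ k : ℤ, u t = k * (2 * π)} :=
    hu.strictMonoOn.injOn.mono fun t ht => Ioc_subset_Icc_self ht.1
  rw [← hinj.encard_image, h1, Function.Injective.encard_image]
  · rw [← Finset.coe_Icc, encard_coe_eq_coe_finsetCard]
    simp
  · intro i j hij
    exact_mod_cast mul_right_cancel₀ hπ.ne' hij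

lemma isGreatest_returnTimes (hu : e.IsUniformization O T q v u) (he : e.IsKeplerian)
    (h0 : q 0 ≠ O) (hne : q T ≠ q 0) {n : ℕ} (hn : 1 ≤ n)
    (hn' : u T < (n + 1) * (2 * π)) {s : ℝ} (hs : s ∈ Icc 0 T) (hus : u s = n * (2 * π)) :
    IsGreatest (returnTimes T q v) s := by
  have hT : 0 ≤ T := hs.1.trans hs.2
  have hm0 : (0 : ℝ) ∈ Icc 0 T := ⟨le_rfl, hT⟩
  have hmT : T ∈ Icc 0 T := ⟨hT, le_rfl⟩
  have hπ := two_pi_pos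
  rw [hu.returnTimes_eq he h0 hne hT]
  refine ⟨⟨⟨hs.1.lt_of_ne ?_, hs.2⟩, n, by simpa using hus⟩, ?_⟩
  · rintro rfl
    rw [hu.zero] at hus
    have h2 : (1 : ℝ) ≤ n := by exact_mod_cast hn
    nlinarith
  · rintro t ⟨ht, k, hk⟩
    have htI := Ioc_subset_Icc_self ht
    rw [← hu.strictMonoOn.le_iff_le htI hs, hk, hus]
    have h3 : u t ≤ u T := hu.strictMonoOn.monotoneOn htI hmT ht.2
    rw [hk] at h3
    have h5 : k < n + 1 := by
      have := lt_of_mul_lt_mul_right (h3.trans_lt hn') hπ.le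
      exact_mod_cast this
    have h6 : (k : ℝ) ≤ n := by exact_mod_cast Int.lt_add_one_iff.1 h5
    gcongr

-- The last part of the arc covers the anomalies from `2πn` to `2πn + 2δ`; by periodicity,
-- recentring at the midpoint turns this interval into `[-δ, δ]`.
open scoped Pointwise in
lemma isDirect_iff (hu : e.IsUniformization O T q v u) {δ : ℝ} {n : ℕ} {s : ℝ} (hs : s ∈ Icc 0 T)
    (hus : u s = n * (2 * π)) (huT : u T = n * (2 * π) + 2 * δ) :
    IsDirect O s T q ↔ (0 : Space d) ∉ convexHull ℝ ((e.shift δ).pos '' Icc (-δ) δ) := by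
  have hmT : T ∈ Icc 0 T := ⟨hs.1.trans hs.2, le_rfl⟩
  have h1 : q '' Icc s T = O +ᵥ ((e.shift δ).pos '' Icc (-δ) δ) := by
    have hp : ∀ w, (e.shift δ).pos (w - δ - n * (2 * π)) = e.pos w := by
      intro w
      rw [Ellipse.pos_shift, ← e.pos_add_int_mul_two_pi _ n]
      push_cast
      ring_nf
    ext x
    rw [mem_vadd_set]
    constructor
    · rintro ⟨t, ht, rfl⟩
      have htI : t ∈ Icc 0 T := ⟨hs.1.trans ht.1, ht.2⟩
      refine ⟨_, ⟨u t - δ - n * (2 * π), ⟨?_, ?_⟩, rfl⟩, ?_⟩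
      · have := hu.strictMonoOn.monotoneOn hs htI ht.1
        linarith
      · have := hu.strictMonoOn.monotoneOn htI hmT ht.2
        linarith
      · rw [hp, ← hu.pos t htI, vadd_eq_add, add_sub_cancel]
    · rintro ⟨_, ⟨w, hw, rfl⟩, rfl⟩
      obtain ⟨t, ht, htw⟩ := intermediate_value_Icc hs.2
        (hu.continuousOn.mono (Icc_subset_Icc_left hs.1))
        (show w + δ + n * (2 * π) ∈ Icc (u s) (u T) from ⟨by linarith [hw.1], by linarith [hw.2]⟩)
      refine ⟨t, ht, ?_⟩
      have h2 := hu.pos t ⟨hs.1.trans ht.1, ht.2⟩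
      rw [← hp, htw, sub_eq_iff_eq_add'] at h2
      rw [h2, vadd_eq_add]
      congr 2
      ring
  rw [IsDirect, h1, convexHull_vadd, mem_vadd_set]
  simp

end Ellipse.IsUniformization

variable {d : ℕ} {O A B : Space d}

lemma zero_notMem_segment_sub (hO : O ∉ segment ℝ A B) :
    (0 : Space d) ∉ segment ℝ (A - O) (B - O) := by
  intro h
  refine hO ?_
  have := (mem_segment_translate ℝ O).2 h
  simpa using this

/-- A uniformized arc is determined by half the final increment of the eccentric anomaly. -/
lemma IsMultiRevDirect.exists_eq_lambertEllipse {n : ℕ} (hn : 1 ≤ n) (hAB : A ≠ B)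
    (hO : O ∉ segment ℝ A B) {T : ℝ} {q v : ℝ → Space d} (h : IsMultiRevDirect O A B n T q v)
    (hT : 0 ≤ T) {e : Ellipse (Space d)} (he : e.IsKeplerian) {u : ℝ → ℝ}
    (hu : e.IsUniformization O T q v u) :
    ∃ δ ∈ Ioo 0 π, u T = n * (2 * π) + 2 * δ ∧
      e = (lambertEllipse (A - O) (B - O) δ).shift (-δ) := by
  have hm0 : (0 : ℝ) ∈ Icc 0 T := ⟨le_rfl, hT⟩
  have hmT : T ∈ Icc 0 T := ⟨hT, le_rfl⟩
  have hπ := two_pi_pos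
  have h0 : q 0 ≠ O := by
    rw [h.initial]
    rintro rfl
    exact hO (left_mem_segment ℝ _ _)
  have hne : q T ≠ q 0 := by
    rw [h.initial, h.final]
    exact hAB.symm
  have huT : 0 ≤ u T := by
    rw [← hu.zero]
    exact hu.strictMonoOn.monotoneOn hm0 hmT hT
  have hle := (le_div_iff₀ hπ).1 (Nat.floor_le (div_nonneg huT hπ.le))
  have hlt := (div_lt_iff₀ hπ).1 (Nat.lt_floor_add_one (u T / (2 * π)))
  -- The number of returns is the number of full turns, which yields `0 ≤ δ < π`; `δ = 0` is
  -- excluded later by `A ≠ B`.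
  have hN : ⌊u T / (2 * π)⌋₊ = n := by
    have h1 := (hu.encard_returnTimes he h0 hne hT hle hlt).symm.trans h.passages
    exact_mod_cast h1
  rw [hN] at hle hlt
  obtain ⟨s, hs, hus⟩ := hu.exists_eq hT (by positivity) hle
  obtain ⟨s', hs', hd⟩ := h.direct
  obtain rfl := hs'.unique (hu.isGreatest_returnTimes he h0 hne hn hlt hs hus)
  obtain ⟨δ, hδ⟩ : ∃ δ, u T = n * (2 * π) + 2 * δ := ⟨(u T - n * (2 * π)) / 2, by ring⟩
  have hpA : (e.shift δ).pos (-δ) = A - O := by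
    rw [Ellipse.pos_shift, neg_add_cancel, ← h.initial, hu.pos 0 hm0, hu.zero]
  have hpB : (e.shift δ).pos δ = B - O := by
    rw [Ellipse.pos_shift, ← h.final, hu.pos T hmT, hδ, ← e.pos_add_int_mul_two_pi _ n]
    push_cast
    ring_nf
  have hδ0 : δ ≠ 0 := by
    rintro rfl
    rw [neg_zero, hpB] at hpA
    exact hAB (sub_left_injective hpA).symm
  have hδI : δ ∈ Ioo 0 π := by
    refine ⟨lt_of_le_of_ne ?_ hδ0.symm, ?_⟩ <;> linarith
  refine ⟨δ, hδI, hδ, ?_⟩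
  rw [← eq_lambertEllipse (zero_notMem_segment_sub hO) hδI (he.shift δ) hpA hpB
    ((hu.isDirect_iff hs hus hδ).1 hd), Ellipse.shift_shift_neg]

lemma isMultiRevDirect_lambertEllipse {n : ℕ} (hn : 1 ≤ n) (hAB : A ≠ B)
    (hO : O ∉ segment ℝ A B) {δ : ℝ} (hδ : δ ∈ Ioo 0 π) {T : ℝ} {e : Ellipse (Space d)}
    (hed : e = (lambertEllipse (A - O) (B - O) δ).shift (-δ))
    (hT : e.time (n * (2 * π) + 2 * δ) = T) :
    IsMultiRevDirect O A B n T (fun t => O + e.pos (e.anomaly t)) e.velocity := by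
  have h0 := zero_notMem_segment_sub hO
  have he : e.IsKeplerian := by
    rw [hed]
    exact (isKeplerian_lambertEllipse h0 (fun h => hAB (sub_left_injective h)) hδ).shift _
  have hs := (sin_pos_of_mem_Ioo hδ).ne'
  have hu := he.isUniformization O T
  have huT : e.anomaly T = n * (2 * π) + 2 * δ := by rw [← hT, he.anomaly_time]
  have hπ := two_pi_pos
  have hδ0 := hδ.1
  have hT0 : 0 ≤ T := by
    rw [← hT, ← e.time_zero]
    exact he.strictMono_time.monotone (by positivity)
  have hsh : e.shift δ = lambertEllipse (A - O) (B - O) δ := by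
    rw [hed]
    simpa using Ellipse.shift_shift_neg (lambertEllipse (A - O) (B - O) δ) (-δ)
  have hp : ∀ w, e.pos w = (lambertEllipse (A - O) (B - O) δ).pos (w - δ) := by
    intro w
    rw [hed, Ellipse.pos_shift, ← sub_eq_add_neg]
  have hi : O + e.pos (e.anomaly 0) = A := by
    rw [he.anomaly_zero, hp, zero_sub, lambertEllipse_pos_neg hs, add_sub_cancel]
  have hf : O + e.pos (e.anomaly T) = B := by
    rw [huT, ← Int.cast_natCast, add_comm ((n : ℤ) * (2 * π)), e.pos_add_int_mul_two_pi, hp,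
      two_mul, add_sub_cancel_right, lambertEllipse_pos hs, add_sub_cancel]
  have h0' : O + e.pos (e.anomaly 0) ≠ O := by
    rw [hi]
    rintro rfl
    exact hO (left_mem_segment ℝ _ _)
  have hne : O + e.pos (e.anomaly T) ≠ O + e.pos (e.anomaly 0) := by
    rw [hi, hf]
    exact hAB.symm
  have hle : n * (2 * π) ≤ e.anomaly T := by linarith
  have hlt : e.anomaly T < (n + 1) * (2 * π) := by linarith [hδ.2]
  obtain ⟨s, hs', hus⟩ := hu.exists_eq hT0 (by positivity) hle
  refine ⟨he.isKeplerMotion O T, hi, hf, hu.encard_returnTimes he h0' hne hT0 hle hlt,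
    s, hu.isGreatest_returnTimes he h0' hne hn hlt hs' hus, ?_⟩
  rw [hu.isDirect_iff hs' hus huT, hsh]
  exact zero_notMem_convexHull_lambertEllipse h0 hδ

end KeplerLambert

/-! ### Conversely, a returning motion runs along an ellipse. -/

namespace KeplerLambert
open Real Set Filter Topology

lemma strictMonoOn_Icc_of_hasDerivAt_pos_off_finite {f f' : ℝ → ℝ} {a b : ℝ} {Z : Set ℝ}
    (hZ : Z.Finite) (hf : ContinuousOn f (Icc a b))
    (hf' : ∀ t ∈ Ioo a b, t ∉ Z → HasDerivAt f (f' t) t ∧ 0 < f' t) :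
    StrictMonoOn f (Icc a b) := by
  induction Z, hZ using Set.Finite.induction_on generalizing a b with
  | empty =>
    refine strictMonoOn_of_deriv_pos (convex_Icc a b) hf fun t ht => ?_
    rw [interior_Icc] at ht
    obtain ⟨h1, h2⟩ := hf' t ht (notMem_empty t)
    rwa [h1.deriv]
  | @insert z Z _ _ ih =>
    by_cases hz : z ∈ Ioo a b
    · rw [← Icc_union_Icc_eq_Icc hz.1.le hz.2.le]
      refine StrictMonoOn.union (ih (hf.mono (Icc_subset_Icc_right hz.2.le)) fun t ht htZ => ?_)
        (ih (hf.mono (Icc_subset_Icc_left hz.1.le)) fun t ht htZ => ?_)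
        (isGreatest_Icc hz.1.le) (isLeast_Icc hz.2.le)
      · exact hf' t ⟨ht.1, ht.2.trans hz.2⟩ (by simp [htZ, ht.2.ne])
      · exact hf' t ⟨hz.1.trans ht.1, ht.2⟩ (by simp [htZ, ht.1.ne'])
    · refine ih hf fun t ht htZ => hf' t ht ?_
      rw [mem_insert_iff, not_or]
      exact ⟨fun h => hz (h ▸ ht), htZ⟩

lemma strictMonoOn_Icc_of_hasDerivWithinAt_pos_off_finite {f f' : ℝ → ℝ} {a b : ℝ} {Z : Set ℝ}
    (hZ : Z.Finite) (hf : ContinuousOn f (Icc a b))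
    (hf' : ∀ t ∈ Icc a b, t ∉ Z → HasDerivWithinAt f (f' t) (Icc a b) t ∧ 0 < f' t) :
    StrictMonoOn f (Icc a b) :=
  strictMonoOn_Icc_of_hasDerivAt_pos_off_finite hZ hf fun t ht htZ =>
    (hf' t (Ioo_subset_Icc_self ht) htZ).imp_left fun h => h.hasDerivAt (Icc_mem_nhds ht.1 ht.2)

lemma eq_left_of_hasDerivWithinAt_zero_off_finite {F : Type*} [NormedAddCommGroup F]
    [NormedSpace ℝ F] [CompleteSpace F] {f : ℝ → F} {a b : ℝ} {Z : Set ℝ}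
    (hZ : Z.Finite) (hf : ContinuousOn f (Icc a b))
    (hf' : ∀ t ∈ Icc a b, t ∉ Z → HasDerivWithinAt f 0 (Icc a b) t) {t : ℝ} (ht : t ∈ Icc a b) :
    f t = f a := by
  have h := MeasureTheory.integral_eq_of_hasDerivAt_off_countable_of_le f (fun _ => 0) ht.1
    hZ.countable (hf.mono (Icc_subset_Icc_right ht.2)) (fun s hs => (hf' s
      ⟨hs.1.1.le, hs.1.2.le.trans ht.2⟩ hs.2).hasDerivAt
        (Icc_mem_nhds hs.1.1 (hs.1.2.trans_le ht.2))) (by simp)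
  simp only [intervalIntegral.integral_zero] at h
  exact (sub_eq_zero.1 h.symm)

/-- The solution of the equation of the harmonic oscillator in a time `u` such that
`du = k * dt`. -/
lemma eq_cos_smul_add_sin_smul {F : Type*} [NormedAddCommGroup F] [NormedSpace ℝ F]
    [CompleteSpace F] {z y : ℝ → F} {u k : ℝ → ℝ} {T : ℝ} {Z : Set ℝ} (hZ : Z.Finite)
    (hz : ContinuousOn z (Icc 0 T)) (hy : ContinuousOn y (Icc 0 T))
    (hu : ContinuousOn u (Icc 0 T)) (hu0 : u 0 = 0)
    (hz' : ∀ t ∈ Icc 0 T, t ∉ Z → HasDerivWithinAt z (k t • y t) (Icc 0 T) t)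
    (hy' : ∀ t ∈ Icc 0 T, t ∉ Z → HasDerivWithinAt y (-(k t • z t)) (Icc 0 T) t)
    (hu' : ∀ t ∈ Icc 0 T, t ∉ Z → HasDerivWithinAt u (k t) (Icc 0 T) t) {t : ℝ}
    (ht : t ∈ Icc 0 T) :
    z t = cos (u t) • z 0 + sin (u t) • y 0 ∧ y t = -(sin (u t) • z 0) + cos (u t) • y 0 := by
  -- Rotating `(z, y)` back by the angle `u` gives constants, even across the finite exceptional
  -- set, by continuity.
  have h1 : cos (u t) • z t - sin (u t) • y t = z 0 := by
    have := eq_left_of_hasDerivWithinAt_zero_off_finite hZ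
      (f := fun t => cos (u t) • z t - sin (u t) • y t)
      (((Real.continuous_cos.comp_continuousOn hu).smul hz).sub
        ((Real.continuous_sin.comp_continuousOn hu).smul hy)) (fun t ht htZ => by
        refine (((hu' t ht htZ).cos.smul (hz' t ht htZ)).sub
          ((hu' t ht htZ).sin.smul (hy' t ht htZ))).congr_deriv ?_
        module) ht
    simpa [hu0] using this
  have h2 : sin (u t) • z t + cos (u t) • y t = y 0 := by
    have := eq_left_of_hasDerivWithinAt_zero_off_finite hZ
      (f := fun t => sin (u t) • z t + cos (u t) • y t)
      (((Real.continuous_sin.comp_continuousOn hu).smul hz).add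
        ((Real.continuous_cos.comp_continuousOn hu).smul hy)) (fun t ht htZ => by
        refine (((hu' t ht htZ).sin.smul (hz' t ht htZ)).add
          ((hu' t ht htZ).cos.smul (hy' t ht htZ))).congr_deriv ?_
        module) ht
    simpa [hu0] using this
  have hsc := sin_sq_add_cos_sq (u t)
  rw [← h1, ← h2]
  constructor
  · calc z t = (sin (u t) ^ 2 + cos (u t) ^ 2) • z t := by rw [hsc, one_smul]
      _ = _ := by module
  · calc y t = (sin (u t) ^ 2 + cos (u t) ^ 2) • y t := by rw [hsc, one_smul]
      _ = _ := by module

/-- The ellipse described from the position `x` and the velocity `v`, when the energy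
is `-1 / (2 * b ^ 2)`. -/
noncomputable def Ellipse.ofState {E : Type*} [NormedAddCommGroup E] [InnerProductSpace ℝ E]
    (b : ℝ) (x v : E) : Ellipse E where
  a := b ^ 2
  ρ := ‖x‖ - b ^ 2
  σ := b * inner ℝ x v
  c := -(b ^ 2 • ((2 * -(2 * b ^ 2)⁻¹ + ‖x‖⁻¹) • x - inner ℝ x v • v))
  X := x + b ^ 2 • ((2 * -(2 * b ^ 2)⁻¹ + ‖x‖⁻¹) • x - inner ℝ x v • v)
  Y := b • ‖x‖ • v

lemma Ellipse.isKeplerian_ofState {E : Type*} [NormedAddCommGroup E] [InnerProductSpace ℝ E]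
    {b : ℝ} (hb : 0 < b) {x v : E} (hx : 0 < ‖x‖)
    (hE : ‖v‖ ^ 2 = 2 * -(2 * b ^ 2)⁻¹ + 2 * ‖x‖⁻¹) : (ofState b x v).IsKeplerian := by
  have hcs := abs_real_inner_le_norm x v
  have hxx := real_inner_self_eq_norm_sq x
  have hvv := real_inner_self_eq_norm_sq v
  rw [hE] at hvv
  -- Multiplied by `b ^ 2`, Cauchy–Schwarz becomes the bound on the eccentricity.
  have hle : (inner ℝ x v) ^ 2 ≤ ‖x‖ ^ 2 * ‖v‖ ^ 2 := by
    rw [← mul_pow]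
    exact sq_le_sq' (neg_le_of_abs_le hcs) (le_of_abs_le hcs)
  rw [hE] at hle
  have hvx : inner ℝ v x = inner ℝ x v := real_inner_comm _ _
  have hX : (ofState b x v).X = (b ^ 2 / ‖x‖) • x - (b ^ 2 * inner ℝ x v) • v := by
    simp only [ofState]
    match_scalars
    · field_simp
      ring
    · ring
  refine ⟨pow_pos hb 2, ?_, ?_, ?_, ?_, ?_⟩
  · rw [hX]
    simp only [ofState, inner_sub_left, inner_sub_right, real_inner_smul_left,
      real_inner_smul_right, hxx, hvv, hvx]
    field_simp
    ring
  · simp only [ofState, real_inner_smul_left, real_inner_smul_right, hvv]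
    field_simp
    ring
  · rw [hX]
    simp only [ofState, inner_sub_left, real_inner_smul_left, real_inner_smul_right, hvv]
    field_simp
    ring
  · simp only [ofState]
    match_scalars
    · field_simp
      ring
    · field_simp
      ring
  · simp only [ofState]
    have : ‖x‖ ^ 2 * (2 * -(2 * b ^ 2)⁻¹ + 2 * ‖x‖⁻¹) =
        (b ^ 2)⁻¹ * (2 * b ^ 2 * ‖x‖ - ‖x‖ ^ 2) := by
      field_simp
      ring
    rw [this, ← mul_le_mul_iff_right₀ (pow_pos hb 2), mul_inv_cancel_left₀ (by positivity)] at hle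
    linarith

namespace IsKeplerMotion

variable {d : ℕ} {O : Space d} {T : ℝ} {q v : ℝ → Space d}

section

variable (h : IsKeplerMotion O 0 T q v) {H : ℝ}
  (hH : ∀ t ∈ Icc 0 T, q t ≠ O → ‖v t‖ ^ 2 / 2 - 1 / ‖q t - O‖ = H)
include h

lemma hasDerivWithinAt_sub {t : ℝ} (ht : t ∈ Icc 0 T) (hq : q t ≠ O) :
    HasDerivWithinAt (fun t => q t - O) (v t) (Icc 0 T) t :=
  (h.velocity t ht hq).sub_const O

lemma hasDerivWithinAt_norm {t : ℝ} (ht : t ∈ Icc 0 T) (hq : q t ≠ O) :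
    HasDerivWithinAt (fun t => ‖q t - O‖) (inner ℝ (q t - O) (v t) / ‖q t - O‖) (Icc 0 T) t := by
  have h0 : ‖q t - O‖ ≠ 0 := norm_ne_zero_iff.2 (sub_ne_zero.2 hq)
  have h1 := ((h.hasDerivWithinAt_sub ht hq).norm_sq).sqrt (pow_ne_zero 2 h0)
  simp only [Real.sqrt_sq (norm_nonneg _)] at h1
  exact h1.congr_deriv (by field_simp)

lemma continuousOn_norm : ContinuousOn (fun t => ‖q t - O‖) (Icc 0 T) :=
  (h.continuousOn.sub continuousOn_const).norm

lemma hasDerivWithinAt_norm_smul {t : ℝ} (ht : t ∈ Icc 0 T) (hq : q t ≠ O) :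
    HasDerivWithinAt (fun t => ‖q t - O‖ • v t)
      ((inner ℝ (q t - O) (v t) / ‖q t - O‖) • v t - (‖q t - O‖ ^ 2)⁻¹ • (q t - O))
      (Icc 0 T) t := by
  have h0 : ‖q t - O‖ ≠ 0 := norm_ne_zero_iff.2 (sub_ne_zero.2 hq)
  refine ((h.hasDerivWithinAt_norm ht hq).smul (h.newton t ht hq)).congr_deriv ?_
  have : (‖q t - O‖ ^ 2)⁻¹ = ‖q t - O‖ * (‖q t - O‖ ^ 3)⁻¹ := by field_simp
  rw [this]
  module

include hH

omit h in
lemma norm_sq_velocity {t : ℝ} (ht : t ∈ Icc 0 T) (hq : q t ≠ O) :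
    ‖v t‖ ^ 2 = 2 * H + 2 * ‖q t - O‖⁻¹ := by
  rw [← hH t ht hq]
  ring

/-- The Lagrange–Jacobi identity, with the kinetic term eliminated by the energy. -/
lemma hasDerivWithinAt_inner {t : ℝ} (ht : t ∈ Icc 0 T) (hq : q t ≠ O) :
    HasDerivWithinAt (fun t => inner ℝ (q t - O) (v t)) (2 * H + ‖q t - O‖⁻¹) (Icc 0 T) t := by
  have h0 : ‖q t - O‖ ≠ 0 := norm_ne_zero_iff.2 (sub_ne_zero.2 hq)
  refine ((h.hasDerivWithinAt_sub ht hq).inner ℝ (h.newton t ht hq)).congr_deriv ?_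
  rw [inner_neg_right, real_inner_smul_right, real_inner_self_eq_norm_sq,
    real_inner_self_eq_norm_sq, norm_sq_velocity hH ht hq]
  field_simp
  ring

omit h in
lemma norm_norm_smul {t : ℝ} (ht : t ∈ Icc 0 T) :
    ‖‖q t - O‖ • v t‖ = √(2 * H * ‖q t - O‖ ^ 2 + 2 * ‖q t - O‖) := by
  rcases eq_or_ne (q t) O with hq | hq
  · simp [hq]
  · have h0 : ‖q t - O‖ ≠ 0 := norm_ne_zero_iff.2 (sub_ne_zero.2 hq)
    rw [← Real.sqrt_sq (norm_nonneg (‖q t - O‖ • v t)), norm_smul, norm_norm, mul_pow,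
      norm_sq_velocity hH ht hq]
    congr 1
    field_simp

/-- The velocity is unbounded at a collision, but the energy gives `‖r v‖ ^ 2 = 2 H r ^ 2 + 2 r`, so
`r v` extends continuously by zero. This makes regularization possible. -/
lemma tendsto_norm_smul {t : ℝ} (hq : q t = O) (ht : t ∈ Icc 0 T) :
    Tendsto (fun t => ‖q t - O‖ • v t) (𝓝[Icc 0 T] t) (𝓝 0) := by
  rw [tendsto_zero_iff_norm_tendsto_zero]
  have h1 : ContinuousOn (fun t => √(2 * H * ‖q t - O‖ ^ 2 + 2 * ‖q t - O‖)) (Icc 0 T) := by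
    have := h.continuousOn_norm
    fun_prop
  have h2 := (h1 t ht).tendsto
  simp only [hq, sub_self, norm_zero, ne_eq, OfNat.ofNat_ne_zero, not_false_eq_true, zero_pow,
    mul_zero, add_zero, Real.sqrt_zero] at h2
  exact h2.congr' (eventually_mem_nhdsWithin.mono fun s hs => (norm_norm_smul hH hs).symm)

lemma continuousOn_norm_smul : ContinuousOn (fun t => ‖q t - O‖ • v t) (Icc 0 T) := by
  intro t ht
  rcases eq_or_ne (q t) O with hq | hq
  · have := h.tendsto_norm_smul hH hq ht
    rw [ContinuousWithinAt]
    simpa [hq] using this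
  · exact (h.hasDerivWithinAt_norm_smul ht hq).continuousWithinAt

lemma continuousOn_inner : ContinuousOn (fun t => inner ℝ (q t - O) (v t)) (Icc 0 T) := by
  intro t ht
  rcases eq_or_ne (q t) O with hq | hq
  · have := (h.tendsto_norm_smul hH hq ht).norm
    rw [norm_zero] at this
    rw [ContinuousWithinAt, hq, sub_self, inner_zero_left]
    refine squeeze_zero_norm (fun s => ?_) this
    rw [norm_smul, norm_norm]
    exact norm_inner_le_norm _ _
  · exact (h.hasDerivWithinAt_inner hH ht hq).continuousWithinAt

/-- The eccentricity vector is a constant of motion. -/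
lemma eccentricity_eq (hT : 0 < T) (h0 : q 0 ≠ O) {t : ℝ} (ht : t ∈ Icc 0 T) (hq : q t ≠ O) :
    (2 * H + ‖q t - O‖⁻¹) • (q t - O) - inner ℝ (q t - O) (v t) • v t =
      (2 * H + ‖q 0 - O‖⁻¹) • (q 0 - O) - inner ℝ (q 0 - O) (v 0) • v 0 := by
  have hm0 : (0 : ℝ) ∈ Icc 0 T := ⟨le_rfl, hT.le⟩
  by_cases hc : ∃ t ∈ Icc 0 T, q t = O
  -- With a collision, differentiation cannot cross it; the bounce condition instead keeps the
  -- motion on one ray, where the vector is minus the unit direction.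
  · have key : ∀ t ∈ Icc 0 T, q t ≠ O →
        (2 * H + ‖q t - O‖⁻¹) • (q t - O) - inner ℝ (q t - O) (v t) • v t =
          -(‖q 0 - O‖⁻¹ • (q 0 - O)) := by
      intro t ht hq
      have hr0 : ‖q 0 - O‖ ≠ 0 := norm_ne_zero_iff.2 (sub_ne_zero.2 h0)
      have hr : ‖q t - O‖ ≠ 0 := norm_ne_zero_iff.2 (sub_ne_zero.2 hq)
      have hx : ∀ s ∈ Icc 0 T, q s - O = ‖q s - O‖ • (‖q 0 - O‖⁻¹ • (q 0 - O)) := by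
        intro s hs
        have h1 := (h.bounce hc 0 hm0 s hs).norm_smul_eq
        rw [smul_comm, ← h1, inv_smul_smul₀ hr0]
      have hv : v t = (inner ℝ (q t - O) (v t) / ‖q t - O‖) • (‖q 0 - O‖⁻¹ • (q 0 - O)) :=
        (uniqueDiffOn_Icc hT t ht).eq_deriv (Icc 0 T) (h.hasDerivWithinAt_sub ht hq)
          (((h.hasDerivWithinAt_norm ht hq).smul_const _).congr hx (hx t ht))
      have hn : ‖‖q 0 - O‖⁻¹ • (q 0 - O)‖ = 1 := by
        rw [norm_smul, norm_inv, norm_norm, inv_mul_cancel₀ hr0]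
      have hE := norm_sq_velocity hH ht hq
      have hxt := hx t ht
      set w : ℝ := inner ℝ (q t - O) (v t)
      set ε := ‖q 0 - O‖⁻¹ • (q 0 - O)
      set r := ‖q t - O‖
      rw [hv, norm_smul, hn, mul_one, norm_div, div_pow, norm_eq_abs, sq_abs, norm_eq_abs,
        sq_abs] at hE
      have h2 : (2 * H + r⁻¹) * r - w * (w / r) = -1 := by
        field_simp at hE ⊢
        linarith
      calc _ = ((2 * H + r⁻¹) * r - w * (w / r)) • ε := by
            rw [hv, hxt]
            module
        _ = _ := by rw [h2, neg_one_smul]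
    rw [key t ht hq, key 0 hm0 h0]
  · push Not at hc
    have hd : ∀ t ∈ Icc 0 T, HasDerivWithinAt (fun t => (2 * H + ‖q t - O‖⁻¹) • (q t - O) -
        inner ℝ (q t - O) (v t) • v t) 0 (Icc 0 T) t := by
      intro t ht
      have hq := hc t ht
      have hr : ‖q t - O‖ ≠ 0 := norm_ne_zero_iff.2 (sub_ne_zero.2 hq)
      refine (((((h.hasDerivWithinAt_norm ht hq).inv hr).const_add (2 * H)).smul
        (h.hasDerivWithinAt_sub ht hq)).sub
        ((h.hasDerivWithinAt_inner hH ht hq).smul (h.newton t ht hq))).congr_deriv ?_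
      have h1 : -(inner ℝ (q t - O) (v t) / ‖q t - O‖) / ‖q t - O‖ ^ 2 =
        -(inner ℝ (q t - O) (v t) * (‖q t - O‖ ^ 3)⁻¹) := by field_simp
      rw [h1]
      module
    exact eq_left_of_hasDerivWithinAt_zero_off_finite finite_empty
      (fun t ht => (hd t ht).continuousWithinAt) (fun t ht _ => hd t ht) ht

end

/-- A motion that passes again through its initial state is a Keplerian motion along an ellipse. -/
theorem exists_isUniformization (h : IsKeplerMotion O 0 T q v) (h0 : q 0 ≠ O) {s : ℝ}
    (hs : s ∈ Ioc 0 T) (hqs : q s = q 0) (hvs : v s = v 0) :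
    ∃ (e : Ellipse (Space d)) (u : ℝ → ℝ), e.IsKeplerian ∧ e.IsUniformization O T q v u := by
  obtain ⟨H, hH⟩ := h.energy
  have hT : 0 < T := hs.1.trans_le hs.2
  have hm0 : (0 : ℝ) ∈ Icc 0 T := ⟨le_rfl, hT.le⟩
  have hZ := h.finite_collisions
  have hr0 : 0 < ‖q 0 - O‖ := norm_pos_iff.2 (sub_ne_zero.2 h0)
  have hZ' : ∀ t ∈ Icc 0 T, t ∉ {t ∈ Icc 0 T | q t = O} → q t ≠ O :=
    fun t ht htZ hq => htZ ⟨ht, hq⟩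
  -- For `0 ≤ H` the inner product `⟨q - O, v⟩` would be strictly increasing, yet it takes equal
  -- values at `0` and `s`.
  have hHneg : H < 0 := by
    by_contra! hH0
    have hmono := strictMonoOn_Icc_of_hasDerivWithinAt_pos_off_finite hZ (h.continuousOn_inner hH)
      (f' := fun t => 2 * H + ‖q t - O‖⁻¹) (fun t ht htZ => ⟨h.hasDerivWithinAt_inner hH ht
        (hZ' t ht htZ), by
        have := norm_pos_iff.2 (sub_ne_zero.2 (hZ' t ht htZ))
        positivity⟩)
    have := hmono hm0 (Ioc_subset_Icc_self hs) hs.1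
    simp only [hqs, hvs, lt_self_iff_false] at this
  obtain ⟨b, hb, rfl⟩ : ∃ b, 0 < b ∧ H = -(2 * b ^ 2)⁻¹ := by
    refine ⟨√(-(2 * H)⁻¹), Real.sqrt_pos.2 (by rw [neg_pos, inv_lt_zero]; linarith), ?_⟩
    rw [Real.sq_sqrt (by rw [neg_nonneg, inv_nonpos]; linarith)]
    have := hHneg.ne
    field_simp
  -- A closed form for the integral of `1 / (b r)`: since `2 * H = -1 / b ^ 2`, the derivative of
  -- the inner product is `1 / r - 1 / b ^ 2`. No singular integral at collisions is needed.
  set u : ℝ → ℝ := fun t => b⁻¹ * (inner ℝ (q t - O) (v t) - inner ℝ (q 0 - O) (v 0) + t / b ^ 2)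
    with hu
  have huc : ContinuousOn u (Icc 0 T) := by
    have := h.continuousOn_inner hH
    fun_prop
  have hu0 : u 0 = 0 := by simp [hu]
  have hud : ∀ t ∈ Icc 0 T, t ∉ {t ∈ Icc 0 T | q t = O} →
      HasDerivWithinAt u ((b * ‖q t - O‖)⁻¹) (Icc 0 T) t := by
    intro t ht htZ
    have hr : ‖q t - O‖ ≠ 0 := norm_ne_zero_iff.2 (sub_ne_zero.2 (hZ' t ht htZ))
    refine ((((h.hasDerivWithinAt_inner hH ht (hZ' t ht htZ)).sub_const _).add
      ((hasDerivWithinAt_id t _).div_const (b ^ 2))).const_mul b⁻¹).congr_deriv ?_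
    field_simp
    ring
  set ε := (2 * -(2 * b ^ 2)⁻¹ + ‖q 0 - O‖⁻¹) • (q 0 - O) - inner ℝ (q 0 - O) (v 0) • v 0 with hε
  set e : Ellipse (Space d) := Ellipse.ofState b (q 0 - O) (v 0)
  have hea : e.a = b ^ 2 := rfl
  have heρ : e.ρ = ‖q 0 - O‖ - b ^ 2 := rfl
  have heσ : e.σ = b * inner ℝ (q 0 - O) (v 0) := rfl
  have hec : e.c = -(b ^ 2 • ε) := rfl
  have heX : e.X = q 0 - O + b ^ 2 • ε := rfl
  have heY : e.Y = b • ‖q 0 - O‖ • v 0 := rfl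
  have hvec : ∀ t ∈ Icc 0 T, q t - O = e.pos (u t) ∧ b • ‖q t - O‖ • v t = e.vel (u t) := by
    intro t ht
    -- In the time `u`, the position relative to the center `-(b ^ 2 • ε)` is a harmonic oscillator;
    -- constancy of `ε` closes the system.
    have := eq_cos_smul_add_sin_smul (z := fun t => q t - O + b ^ 2 • ε)
      (y := fun t => b • ‖q t - O‖ • v t) (k := fun t => (b * ‖q t - O‖)⁻¹) hZ
      ((h.continuousOn.sub continuousOn_const).add continuousOn_const)
      ((h.continuousOn_norm_smul hH).const_smul b) huc hu0 ?_ ?_ hud ht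
    · refine ⟨?_, this.2⟩
      rw [Ellipse.pos, hec, heX, heY, add_assoc, ← this.1, neg_add_cancel_comm_assoc]
    · intro t ht htZ
      have hr : ‖q t - O‖ ≠ 0 := norm_ne_zero_iff.2 (sub_ne_zero.2 (hZ' t ht htZ))
      refine ((h.hasDerivWithinAt_sub ht (hZ' t ht htZ)).add_const _).congr_deriv ?_
      rw [smul_smul b, inv_smul_smul₀ (mul_ne_zero hb.ne' hr)]
    · intro t ht htZ
      have hr : ‖q t - O‖ ≠ 0 := norm_ne_zero_iff.2 (sub_ne_zero.2 (hZ' t ht htZ))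
      refine ((h.hasDerivWithinAt_norm_smul ht (hZ' t ht htZ)).const_smul b).congr_deriv ?_
      rw [hε, ← h.eccentricity_eq hH hT h0 ht (hZ' t ht htZ)]
      generalize q t - O = x at hr ⊢
      match_scalars
      · field_simp
      · field_simp
        ring
  have hrad : ∀ t ∈ Icc 0 T, ‖q t - O‖ = e.rad (u t) ∧
      b * inner ℝ (q t - O) (v t) = e.radVel (u t) := by
    intro t ht
    have := eq_cos_smul_add_sin_smul (z := fun t => ‖q t - O‖ - b ^ 2)
      (y := fun t => b * inner ℝ (q t - O) (v t)) (k := fun t => (b * ‖q t - O‖)⁻¹) hZ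
      (h.continuousOn_norm.sub continuousOn_const)
      (continuousOn_const.mul (h.continuousOn_inner hH)) huc hu0 ?_ ?_ hud ht
    · simp only [smul_eq_mul] at this
      constructor
      · rw [Ellipse.rad, hea, heρ, heσ]
        linarith [this.1]
      · rw [this.2, Ellipse.radVel, heρ, heσ]
        ring
    · intro t ht htZ
      have hr : ‖q t - O‖ ≠ 0 := norm_ne_zero_iff.2 (sub_ne_zero.2 (hZ' t ht htZ))
      refine ((h.hasDerivWithinAt_norm ht (hZ' t ht htZ)).sub_const _).congr_deriv ?_
      rw [smul_eq_mul]
      field_simp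
    · intro t ht htZ
      have hr : ‖q t - O‖ ≠ 0 := norm_ne_zero_iff.2 (sub_ne_zero.2 (hZ' t ht htZ))
      refine ((h.hasDerivWithinAt_inner hH ht (hZ' t ht htZ)).const_mul b).congr_deriv ?_
      rw [smul_eq_mul]
      field_simp
      ring
  have hsb : √e.a = b := Real.sqrt_sq hb.le
  refine ⟨e, u, ?_, ?_, huc, hu0, fun t ht => (hvec t ht).1, ?_, ?_⟩
  · exact Ellipse.isKeplerian_ofState hb hr0 (norm_sq_velocity hH hm0 h0)
  · refine strictMonoOn_Icc_of_hasDerivWithinAt_pos_off_finite hZ huc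
      (f' := fun t => (b * ‖q t - O‖)⁻¹) fun t ht htZ => ⟨hud t ht htZ, ?_⟩
    have := norm_pos_iff.2 (sub_ne_zero.2 (hZ' t ht htZ))
    positivity
  · intro t ht
    rw [hsb, ← (hrad t ht).1, ← (hvec t ht).2, mul_smul]
  · intro t ht
    have h1 := (hrad t ht).2
    rw [Ellipse.radVel] at h1
    rw [Ellipse.time, hsb]
    -- Kepler's equation is the definition of `u`, once `b * ⟨q - O, v⟩` is recognized as `radVel`.
    have h2 : e.a * u t = b * (inner ℝ (q t - O) (v t) - inner ℝ (q 0 - O) (v 0)) + t / b := by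
      rw [hea]
      simp only [hu]
      field_simp
    rw [h2]
    have h4 : b * (inner ℝ (q t - O) (v t) - inner ℝ (q 0 - O) (v 0)) + t / b +
        e.ρ * sin (u t) + e.σ * (1 - cos (u t)) = t / b := by linarith
    rw [h4]
    field_simp

end IsKeplerMotion

end KeplerLambert

/-! ### The bijection between arcs and values of `δ`, and the count. -/

namespace KeplerLambert
open Real Set

variable {d : ℕ}

/-- The Keplerian arc from `A` to `B` around `O` associated with half the increment of the eccentric
anomaly along its last, direct, part. -/
noncomputable def lambertArc (O A B : Space d) (T δ : ℝ) : Icc (0 : ℝ) T → Space d :=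
  fun t => O + ((lambertEllipse (A - O) (B - O) δ).shift (-δ)).pos
    (((lambertEllipse (A - O) (B - O) δ).shift (-δ)).anomaly t)

namespace Ellipse.IsUniformization

variable {e e' : Ellipse (Space d)} {O : Space d} {T : ℝ} {q v q' v' : ℝ → Space d} {u u' : ℝ → ℝ}

lemma radVel_eq (hu : e.IsUniformization O T q v u) (he : e.IsKeplerian) {t : ℝ}
    (ht : t ∈ Icc 0 T) (hq : q t ≠ O) : e.radVel (u t) = √e.a * inner ℝ (q t - O) (v t) := by
  have hr : e.rad (u t) ≠ 0 := by
    rw [← he.norm_pos, ← hu.pos t ht]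
    exact norm_ne_zero_iff.2 (sub_ne_zero.2 hq)
  have h1 := he.inner_pos_vel (u t)
  rw [← hu.pos t ht, ← hu.vel t ht, real_inner_smul_right] at h1
  refine mul_left_cancel₀ hr ?_
  linarith

/-- The vis-viva relation: the semi-major axis depends only on the state at one instant. -/
lemma a_mul_eq (hu : e.IsUniformization O T q v u) (he : e.IsKeplerian) {t : ℝ}
    (ht : t ∈ Icc 0 T) (hq : q t ≠ O) :
    e.a * (2 - ‖q t - O‖ * ‖v t‖ ^ 2) = ‖q t - O‖ := by
  have hr : ‖q t - O‖ ≠ 0 := norm_ne_zero_iff.2 (sub_ne_zero.2 hq)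
  have h1 := he.inner_vel_vel (u t)
  rw [← hu.vel t ht, ← he.norm_pos, ← hu.pos t ht, real_inner_self_eq_norm_sq, norm_smul, mul_pow,
    norm_mul, mul_pow, norm_norm, norm_eq_abs, sq_abs, Real.sq_sqrt he.a_pos.le] at h1
  refine mul_left_cancel₀ hr ?_
  linarith

/-- The increment of the eccentric anomaly is determined by the initial and final states and by the
elapsed time. -/
lemma anomaly_eq (hu : e.IsUniformization O T q v u) (he : e.IsKeplerian)
    (hu' : e'.IsUniformization O T q' v' u') (he' : e'.IsKeplerian) (hT : 0 ≤ T) (h0 : q 0 ≠ O)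
    (h1 : q T ≠ O) (hq0 : q 0 = q' 0) (hv0 : v 0 = v' 0) (hqT : q T = q' T) (hvT : v T = v' T) :
    u T = u' T := by
  have hm0 : (0 : ℝ) ∈ Icc 0 T := ⟨le_rfl, hT⟩
  have hmT : T ∈ Icc 0 T := ⟨hT, le_rfl⟩
  have ha : e.a = e'.a := by
    have h2 := hu.a_mul_eq he hm0 h0
    have h3 := hu'.a_mul_eq he' hm0 (hq0 ▸ h0)
    rw [← hq0, ← hv0] at h3
    refine mul_right_cancel₀ (fun h => ?_) (h2.trans h3.symm)
    rw [h, mul_zero, eq_comm, norm_eq_zero, sub_eq_zero] at h2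
    exact h0 h2
  have hσ : e.radVel (u 0) = e'.radVel (u' 0) := by
    rw [hu.radVel_eq he hm0 h0, hu'.radVel_eq he' hm0 (hq0 ▸ h0), ha, hq0, hv0]
  have hw : e.radVel (u T) = e'.radVel (u' T) := by
    rw [hu.radVel_eq he hmT h1, hu'.radVel_eq he' hmT (hqT ▸ h1), ha, hqT, hvT]
  have h2 : e.time (u T) = e'.time (u' T) := by rw [hu.time T hmT, hu'.time T hmT]
  rw [hu.zero, hu'.zero] at hσ
  simp only [radVel, sin_zero, cos_zero, mul_zero, neg_zero, zero_add, mul_one] at hσ hw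
  rw [Ellipse.time, Ellipse.time, ← ha] at h2
  -- Kepler's equation reads `time u = √a (a u - radVel u + radVel 0)`, so equal `a`, equal `radVel`
  -- at both ends and equal times give equal anomalies.
  have h3 := mul_left_cancel₀ (Real.sqrt_pos.2 he.a_pos).ne' h2
  refine mul_left_cancel₀ he.a_pos.ne' ?_
  linarith

end Ellipse.IsUniformization

lemma IsKeplerMotion.velocity_eq {O : Space d} {T : ℝ} {q v q' v' : ℝ → Space d}
    (h : IsKeplerMotion O 0 T q v) (h' : IsKeplerMotion O 0 T q' v') (hT : 0 < T)
    (hq : ∀ t ∈ Icc 0 T, q t = q' t) {t : ℝ} (ht : t ∈ Icc 0 T) (h0 : q t ≠ O) : v t = v' t :=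
  (uniqueDiffOn_Icc hT t ht).eq_deriv (Icc 0 T) (h.velocity t ht h0)
    ((h'.velocity t ht (hq t ht ▸ h0)).congr hq (hq t ht))

theorem multiRevDirectArcs_eq_image {O A B : Space d} (hAB : A ≠ B) (hO : O ∉ segment ℝ A B)
    {n : ℕ} (hn : 1 ≤ n) (T : ℝ) :
    multiRevDirectArcs O A B n T = lambertArc O A B T ''
      {δ ∈ Ioo 0 π | flightTime (meanRad (A - O) (B - O)) (lambertInv (A - O) (B - O))
        (n * π) δ = T} := by
  ext γ
  constructor
  · rintro ⟨q, v, h, hγ⟩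
    obtain ⟨s, ⟨⟨hs, hqs, hvs⟩, _⟩, _⟩ := h.direct
    have hT : 0 < T := hs.1.trans_le hs.2
    have h0 : q 0 ≠ O := by
      rw [h.initial]
      rintro rfl
      exact hO (left_mem_segment ℝ _ _)
    obtain ⟨e, u, he, hu⟩ := h.motion.exists_isUniformization h0 hs hqs hvs
    obtain ⟨δ, hδ, huT, hed⟩ := h.exists_eq_lambertEllipse hn hAB hO hT.le he hu
    refine ⟨δ, ⟨hδ, ?_⟩, ?_⟩
    · rw [← time_lambertEllipse (sin_pos_of_mem_Ioo hδ).ne', ← hed, ← huT,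
        hu.time T ⟨hT.le, le_rfl⟩]
    · funext t
      rw [lambertArc, ← hed, hγ]
      have h1 : e.anomaly t = u t := by
        rw [← he.anomaly_time (u t), hu.time t t.2]
      rw [h1, ← hu.pos t t.2, add_sub_cancel]
  · rintro ⟨δ, ⟨hδ, hT⟩, rfl⟩
    rw [← time_lambertEllipse (sin_pos_of_mem_Ioo hδ).ne'] at hT
    exact ⟨_, _, isMultiRevDirect_lambertEllipse hn hAB hO hδ rfl hT, fun t => rfl⟩

/-- Equal arcs have equal velocities at both ends, neither of which is a collision; hence the final
anomalies `2πn + 2δ` agree. -/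
theorem injOn_lambertArc {O A B : Space d} (hAB : A ≠ B) (hO : O ∉ segment ℝ A B)
    {n : ℕ} (hn : 1 ≤ n) (T : ℝ) :
    InjOn (lambertArc O A B T)
      {δ ∈ Ioo 0 π | flightTime (meanRad (A - O) (B - O)) (lambertInv (A - O) (B - O))
        (n * π) δ = T} := by
  rintro δ₁ ⟨hδ₁, hT₁⟩ δ₂ ⟨hδ₂, hT₂⟩ heq
  rw [← time_lambertEllipse (sin_pos_of_mem_Ioo hδ₁).ne'] at hT₁
  rw [← time_lambertEllipse (sin_pos_of_mem_Ioo hδ₂).ne'] at hT₂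
  have h0 := zero_notMem_segment_sub hO
  have hAB' : A - O ≠ B - O := fun h => hAB (sub_left_injective h)
  have he₁ := (isKeplerian_lambertEllipse h0 hAB' hδ₁).shift (-δ₁)
  have he₂ := (isKeplerian_lambertEllipse h0 hAB' hδ₂).shift (-δ₂)
  have hm₁ := isMultiRevDirect_lambertEllipse hn hAB hO hδ₁ rfl hT₁
  have hm₂ := isMultiRevDirect_lambertEllipse hn hAB hO hδ₂ rfl hT₂
  have hu₁ := he₁.isUniformization O T
  have hu₂ := he₂.isUniformization O T
  obtain ⟨s, ⟨⟨hs, _⟩, _⟩, _⟩ := hm₁.direct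
  have hT : 0 < T := hs.1.trans_le hs.2
  have hI0 : (0 : ℝ) ∈ Icc 0 T := ⟨le_rfl, hT.le⟩
  have hIT : T ∈ Icc 0 T := ⟨hT.le, le_rfl⟩
  have hq0 := hm₁.initial.trans_ne (show A ≠ O by rintro rfl; exact hO (left_mem_segment ℝ _ _))
  have hqT := hm₁.final.trans_ne (show B ≠ O by rintro rfl; exact hO (right_mem_segment ℝ _ _))
  set e₁ := (lambertEllipse (A - O) (B - O) δ₁).shift (-δ₁)
  set e₂ := (lambertEllipse (A - O) (B - O) δ₂).shift (-δ₂)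
  have hq : ∀ t ∈ Icc 0 T, O + e₁.pos (e₁.anomaly t) = O + e₂.pos (e₂.anomaly t) :=
    fun t ht => congrFun heq ⟨t, ht⟩
  have hv := fun t ht => hm₁.motion.velocity_eq (t := t) hm₂.motion hT hq ht
  have h := hu₁.anomaly_eq he₁ hu₂ he₂ hT.le hq0 hqT (hq 0 hI0) (hv 0 hI0 hq0) (hq T hIT)
    (hv T hIT hqT)
  rw [← hT₁, he₁.anomaly_time, hT₁, ← hT₂, he₂.anomaly_time] at h
  linarith

end KeplerLambert

theorem mainTheorem3 {d : ℕ} (hd : d = 2 ∨ d = 3) (O A B : KeplerLambert.Space d)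
    (hOA : O ≠ A) (hOB : O ≠ B) (hAB : A ≠ B) (hO : O ∉ segment ℝ A B)
    (n : ℕ) (hn : 1 ≤ n) :
    ∃ Tmin : ℝ, 0 < Tmin ∧
      (∀ T : ℝ, T < Tmin → KeplerLambert.multiRevDirectArcs O A B n T = ∅) ∧
      (KeplerLambert.multiRevDirectArcs O A B n Tmin).encard = 1 ∧
      (∀ T : ℝ, Tmin < T → (KeplerLambert.multiRevDirectArcs O A B n T).encard = 2) := by
  have h0 := KeplerLambert.zero_notMem_segment_sub hO
  have hn' : (0 : ℝ) < n := by exact_mod_cast hn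
  obtain ⟨Tmin, hpos, hlt, heq, hgt⟩ := KeplerLambert.exists_min_flightTime
    (KeplerLambert.lambertInv_pos h0) (KeplerLambert.lambertInv_lt_meanRad h0
      fun h => hAB (sub_left_injective h)) (mul_pos hn' Real.pi_pos)
  have himage := KeplerLambert.multiRevDirectArcs_eq_image hAB hO hn
  have hinj := KeplerLambert.injOn_lambertArc hAB hO hn
  refine ⟨Tmin, hpos, fun T hT => ?_, ?_, fun T hT => ?_⟩
  · rw [himage, hlt T hT, Set.image_empty]
  · rw [himage, (hinj Tmin).encard_image, heq]
  · rw [himage, (hinj T).encard_image, hgt T hT]
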